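/- Let $X$ be a complex analytic space (Hausdorff, not necessarily reduced) with a point $x$, and let $\alpha\colon Z\hookrightarrow X$ and $\iota\colon W\hookrightarrow X$ be closed immersions of complex analytic spaces, with points $z\in Z$, $w\in W$ such that $\alpha(z)=x=\iota(w)$; thus $(Z,z)$ and $(W,w)$ represent closed subspace germs of the germ $(X,x)$. Let $X\sqcup_Z X$ be the gluing of two copies of $X$ along $Z$, i.e. the pushout of $\alpha$ with itself in (locally) ringed spaces, with its two natural maps $f_1,f_2\colon X\to X\sqcup_Z X$, and let $v=f_1(x)=f_2(x)$. For a morphism of locally ringed spaces $\varphi\colon T\to V$ and a point $t\in T$, let $R=\mathcal O_{V,\varphi(t)}$, let $\kappa$ be the residue field of the local ring $R$, regard $\mathcal O_{T,t}$ as an $R$-module through $\varphi$, and let $$P^{(V,\varphi(t))}_{(T,t)}(\tau)=\sum_{i\ge 0}\dim_{\kappa}\operatorname{Tor}_i^{R}(\mathcal O_{T,t},\kappa)\,\tau^i\in\mathbb Z[[\tau]],$$ whenever all these dimensions (the Betti numbers of $(T,t)$ over $(V,\varphi(t))$) are finite. Then the Betti numbers of $(Z,z)$ and of $(W,w)$ over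 $(X,x)$ are finite, and so are the Betti numbers of $(W,w)$ over $(X\sqcup_Z X,v)$, where $W$ is mapped to $X\sqcup_Z X$ by $f_1\circ\iota$ or by $f_2\circ\iota$. The power series $2-P^{(X,x)}_{(Z,z)}(\tau)$ is invertible in $\mathbb Z[[\tau]]$ and, for either of these two maps, $$P^{(X\sqcup_Z X,\,v)}_{(W,w)}(\tau)=\frac{P^{(X,x)}_{(W,w)}(\tau)}{2-P^{(X,x)}_{(Z,z)}(\tau)}.$$ -/

import Mathlib

open CategoryTheory CategoryTheory.Limits AlgebraicGeometry TopologicalSpace Opposite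

noncomputable section

namespace Gluing

/-! ### Betti numbers and Poincaré series over a local ring -/

section Poincare

universe u

lemma homologyMap_smul {R : Type u} [CommRing R] {K L : ChainComplex (ModuleCat.{u} R) ℕ}
    (φ : K ⟶ L) (r : R) (i : ℕ) :
    HomologicalComplex.homologyMap (r • φ) i = r • HomologicalComplex.homologyMap φ i :=
  ShortComplex.homologyMap_smul
    (φ := (HomologicalComplex.shortComplexFunctor _ _ i).map φ) (a := r)

/-- A scalar `r` acts on `Tor_i(M, N)` through its action on `N`. -/
lemma tor_map_smul_id {R : Type u} [CommRing R] (M N : ModuleCat.{u} R) (i : ℕ) (r : R) :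
    ((Tor (ModuleCat.{u} R) i).obj M).map (r • 𝟙 N) =
      r • 𝟙 (((Tor (ModuleCat.{u} R) i).obj M).obj N) := by
  let F := (MonoidalCategory.tensoringLeft (ModuleCat.{u} R)).obj M
  have : F.Linear R := ⟨fun f r => by simp [F]⟩
  let P := projectiveResolution N
  have h := Functor.leftDerived_map_eq F i (r • 𝟙 N) (P := P) (Q := P) (r • 𝟙 P.complex) (by
    rw [Linear.smul_comp]
    ext x
    simp only [Category.id_comp, HomologicalComplex.smul_f_apply, HomologicalComplex.comp_f,
      ChainComplex.single₀_map_f_zero]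
    rfl)
  change (F.leftDerived i).map (r • 𝟙 N) = r • 𝟙 ((F.leftDerived i).obj N)
  rw [h, Functor.comp_map, Functor.map_smul, CategoryTheory.Functor.map_id]
  change _ ≫ HomologicalComplex.homologyMap (r • 𝟙 _) i ≫ _ = _
  rw [homologyMap_smul, HomologicalComplex.homologyMap_id]
  erw [Linear.smul_comp, Linear.comp_smul, Category.id_comp, Iso.hom_inv_id]

lemma tor_map_zero {R : Type u} [CommRing R] (M N N' : ModuleCat.{u} R) (i : ℕ) :
    ((Tor (ModuleCat.{u} R) i).obj M).map (0 : N ⟶ N') = 0 := by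
  let F := (MonoidalCategory.tensoringLeft (ModuleCat.{u} R)).obj M
  have h := Functor.leftDerived_map_eq F i (0 : N ⟶ N') (P := projectiveResolution N)
    (Q := projectiveResolution N') 0 (by simp)
  change (F.leftDerived i).map (0 : N ⟶ N') = 0
  rw [h, Functor.map_zero, zero_comp, comp_zero]

/-- The maximal ideal of a local ring `R` kills `Tor_i(M, κ)`, `κ` the residue field. -/
lemma tor_residueField_isTorsionBySet {R : Type u} [CommRing R] [IsLocalRing R]
    (M : ModuleCat.{u} R) (i : ℕ) :
    Module.IsTorsionBySet R
      (((Tor (ModuleCat.{u} R) i).obj M).obj (ModuleCat.of R (IsLocalRing.ResidueField R)))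
      (IsLocalRing.maximalIdeal R : Set R) := by
  rintro t ⟨r, hr⟩
  have h0 : (r • 𝟙 (ModuleCat.of R (IsLocalRing.ResidueField R))) = 0 := by
    ext x
    obtain ⟨s, rfl⟩ := IsLocalRing.residue_surjective x
    change r • (IsLocalRing.residue R s) = 0
    rw [Algebra.smul_def]
    change IsLocalRing.residue R r * _ = 0
    rw [(IsLocalRing.residue_eq_zero_iff r).2 hr, zero_mul]
  have h := tor_map_smul_id M (ModuleCat.of R (IsLocalRing.ResidueField R)) i r
  rw [h0, tor_map_zero] at h
  exact (ConcreteCategory.congr_hom h t).symm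

variable (R : Type u) [CommRing R] [IsLocalRing R] (M : ModuleCat.{u} R)

/-- The `R`-module `Tor_i^R(M, κ)`, with `κ` the residue field of the local ring `R`. -/
abbrev torResidueField (i : ℕ) : ModuleCat.{u} R :=
  ((Tor (ModuleCat.{u} R) i).obj M).obj (ModuleCat.of R (IsLocalRing.ResidueField R))

/-- `Tor_i^R(M, κ)` is a vector space over the residue field `κ` of `R`, on which a class
`[r]` in `κ` acts as `r`. -/
instance torResidueFieldModule (i : ℕ) :
    Module (IsLocalRing.ResidueField R) (torResidueField R M i) :=
  (tor_residueField_isTorsionBySet M i).module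

/-- All the vector spaces `Tor_i^R(M, κ)` are finite dimensional. -/
def HasFiniteBettiNumbers : Prop :=
  ∀ i, Module.Finite (IsLocalRing.ResidueField R) (torResidueField R M i)

/-- The `i`-th Betti number `dim_κ Tor_i^R(M, κ)` (meaningful when this is finite). -/
def bettiNumber (i : ℕ) : ℕ :=
  Module.finrank (IsLocalRing.ResidueField R) (torResidueField R M i)

/-- The Poincaré series `∑ i, dim_κ Tor_i^R(M, κ) t ^ i`. -/
def poincareSeries : PowerSeries ℤ :=
  PowerSeries.mk fun i => (bettiNumber R M i : ℤ)

end Poincare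

/-! ### Complex analytic spaces -/

/-- An open subset `Ω` of `ℂⁿ` with its sheaf of holomorphic functions (a function on an open
subset of `ℂⁿ` is holomorphic if and only if it is infinitely differentiable over `ℂ`). -/
abbrev holomorphicSpace {n : ℕ} (Ω : Opens (Fin n → ℂ)) : LocallyRingedSpace.{0} :=
  ChartedSpace.locallyRingedSpace (modelWithCornersSelf ℂ (Fin n → ℂ)) Ω

/-- The ring of holomorphic functions on `Ω`. -/
abbrev HolomorphicFunctions {n : ℕ} (Ω : Opens (Fin n → ℂ)) : CommRingCat.{0} :=
  (holomorphicSpace Ω).presheaf.obj (op ⊤)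

/-- The common zero set in `Ω` of a finite family of holomorphic functions on `Ω`. -/
def zeroLocus {n k : ℕ} (Ω : Opens (Fin n → ℂ)) (f : Fin k → HolomorphicFunctions Ω) :
    Set (holomorphicSpace Ω) :=
  {q | ∀ j, (f j).1 ⟨q, trivial⟩ = 0}

/-- A closed immersion of locally ringed spaces: a closed embedding of the underlying spaces,
with surjective homomorphisms between the stalks of the structure sheaves. -/
structure IsClosedImmersion {Y X : LocallyRingedSpace.{0}} (φ : Y ⟶ X) : Prop where
  isClosedEmbedding : Topology.IsClosedEmbedding φ.base
  stalkMap_surjective : ∀ y : Y, Function.Surjective (φ.stalkMap y).hom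

/-- `V` is isomorphic to a local model: the zero set of finitely many holomorphic functions
`f₁, …, f_k` on an open set `Ω ⊆ ℂⁿ`, with the structure sheaf `𝒪_Ω / (f₁, …, f_k)`. The
isomorphism is given as a closed immersion of `V` in `Ω` whose image is this zero set, and for
which the kernel of `𝒪_Ω → 𝒪_V` is, stalk by stalk, generated by the germs of the `f_j`. -/
def IsLocalModel (V : LocallyRingedSpace.{0}) : Prop :=
  ∃ (n k : ℕ) (Ω : Opens (Fin n → ℂ)) (f : Fin k → HolomorphicFunctions Ω)
    (ι : V ⟶ holomorphicSpace Ω),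
    IsClosedImmersion ι ∧
    Set.range ι.base = zeroLocus Ω f ∧
    ∀ v : V, RingHom.ker (ι.stalkMap v).hom =
      Ideal.span (Set.range fun j =>
        (holomorphicSpace Ω).presheaf.germ ⊤ (ι.base v) trivial (f j))

/-- A (complex) analytic space: a Hausdorff locally ringed space, each point of which has an
open neighbourhood isomorphic to a local model, as a locally ringed space. Local models may be
non-reduced; reduced analytic spaces are included, as the ideal sheaf of an analytic set is locally
finitely generated. No `ℂ`-algebra structure is fixed, so morphisms of locally ringed spaces
include all the holomorphic maps. -/
structure IsAnalyticSpace (X : LocallyRingedSpace.{0}) : Prop where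
  t2Space : T2Space X
  exists_isLocalModel : ∀ p : X, ∃ U : Opens X, p ∈ U ∧
    IsLocalModel (X.restrict U.isOpenEmbedding)

/-! ### Gluing, and Poincaré series of subspaces -/

/-- The gluing `X ⊔_Z Y` of `X` and `Y` along `α : Z ⟶ X` and `β : Z ⟶ Y`: the pushout in locally
ringed spaces (its underlying ringed space is also the pushout in ringed spaces). -/
abbrev gluing {X Y Z : LocallyRingedSpace.{0}} (α : Z ⟶ X) (β : Z ⟶ Y) :
    LocallyRingedSpace.{0} :=
  pushout α β

variable {V W : LocallyRingedSpace.{0}}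

/-- The stalk `𝒪_{W,w}`, as a module over `𝒪_{V,φ(w)}` through `φ : W ⟶ V`. -/
abbrev stalkModule (φ : W ⟶ V) (w : W) : ModuleCat (V.presheaf.stalk (φ.base w)) :=
  (ModuleCat.restrictScalars (φ.stalkMap w).hom).obj (ModuleCat.of _ (W.presheaf.stalk w))

/-- The Betti numbers of the germ of `W` at `w`, as a subspace of `V` through `φ : W ⟶ V`,
are finite. -/
def FiniteBetti (φ : W ⟶ V) (w : W) : Prop :=
  HasFiniteBettiNumbers (V.presheaf.stalk (φ.base w)) (stalkModule φ w)

/-- The Poincaré series of the germ of `W` at `w`, as a subspace of `V` through `φ : W ⟶ V`: the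
Poincaré series of the `𝒪_{V,φ(w)}`-module `𝒪_{W,w}`. -/
def germPoincareSeries (φ : W ⟶ V) (w : W) : PowerSeries ℤ :=
  poincareSeries (V.presheaf.stalk (φ.base w)) (stalkModule φ w)

end Gluing

end

/-! Write R, S, T for the stalks of X, Z, W at the given points, σ : R → S for the surjection
induced by α, and A for the stalk of the gluing at v. The proof has an algebraic half and a
geometric half, joined by the fact that A is the fibre product R ×_S R (`isFibreProduct_stalk`).

Algebra. The diagonal R → A is a ring section of both projections p₁ and p₂. For such a retract,
P^A_M = P^R_M · P^A_R for every finite R-module M (`poincareSeries_of_section`): the section lifts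
the matrices of a minimal R-resolution of M to A, and combining them with a minimal A-resolution of
R gives a double complex whose total complex is a minimal A-resolution of M. Now p₂ identifies ker
p₁ with ker σ, and P_{A/J} = 1 + τ P_J for a proper ideal J. With Q₁, Q₂ the series of R over A
through p₁, p₂, and P the series of ker σ over R, this gives Q₁ = 1 + τ P Q₂ and, by symmetry, Q₂ =
1 + τ P Q₁. Subtracting yields Q₁ = Q₂, hence Q₁ (1 - τ P) = 1, where 1 - τ P = 2 - P^R_S. One more
use of the retract formula, for M = T, gives the theorem (`IsFibreProduct.poincareSeries_comp`).

Finiteness. Minimal resolutions of finite rank require R to be noetherian; A then embeds in R × R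
and is noetherian too. A stalk of an analytic space is a quotient of a stalk of holomorphic
functions on ℂⁿ, which is a quotient of the ring of convergent power series. The latter is
noetherian by division with remainder (`exists_division`) and Dickson's lemma. Exponents are ordered
by the integer ∏ pᵢ ^ αᵢ, with pᵢ distinct primes, and the norm with parameter s weights an exponent
by the power -s of that integer, so that for large s the leading term dominates each divisor.

Geometry. Sections of the gluing are pairs of sections on the two copies of X that agree on Z. The
codiagonal X ⊔_Z X → X supplies neighbourhoods of v with the same prescribed trace on both copies.
-/

noncomputable section

namespace Gluing

/-! ### Tor against the residue field along a minimal presentation -/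

section BettiRecursion

universe u

open MonoidalCategory TensorProduct

variable {A : Type u} [CommRing A]

lemma shortExact_tensorLeft_map {S : ShortComplex (ModuleCat.{u} A)} (hS : S.ShortExact)
    (P : ModuleCat.{u} A) [Module.Flat A P] :
    (S.map (tensorRight P)).ShortExact :=
  hS.map_of_exact (tensorRight P)

/-- The functor `M ↦ M ⊗ P` with values in chain complexes. -/
abbrev tensorComplex (P : ChainComplex (ModuleCat.{u} A) ℕ) :
    ModuleCat.{u} A ⥤ ChainComplex (ModuleCat.{u} A) ℕ where
  obj M := (((tensoringLeft (ModuleCat.{u} A)).obj M).mapHomologicalComplex _).obj P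
  map f := (NatTrans.mapHomologicalComplex ((tensoringLeft (ModuleCat.{u} A)).map f) _).app P

instance (P : ChainComplex (ModuleCat.{u} A) ℕ) : (tensorComplex P).PreservesZeroMorphisms where
  map_zero M N := by ext i : 1; simp [tensorComplex]; rfl

lemma shortExact_tensorComplex {S : ShortComplex (ModuleCat.{u} A)} (hS : S.ShortExact)
    (P : ChainComplex (ModuleCat.{u} A) ℕ) [∀ i, Module.Flat A (P.X i)] :
    (S.map (tensorComplex P)).ShortExact := by
  apply HomologicalComplex.shortExact_of_degreewise_shortExact
  intro i
  exact shortExact_tensorLeft_map hS (P.X i)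

/-- Tensoring with a flat module preserves the exactness of the resolution in positive degrees. -/
lemma isZero_homology_tensorComplex {κ : ModuleCat.{u} A} (P : ProjectiveResolution κ)
    (F : ModuleCat.{u} A) [Module.Flat A F] (i : ℕ) :
    IsZero (((tensorComplex P.complex).obj F).homology (i + 1)) := by
  rw [← HomologicalComplex.exactAt_iff_isZero_homology]
  have h := P.complex_exactAt_succ i
  rw [HomologicalComplex.exactAt_iff] at h ⊢
  exact h.map (tensorLeft F)

variable [IsLocalRing A]

/-- The complex whose homology is `Tor_i(M, κ)`. -/
abbrev residueTensorComplex : ModuleCat.{u} A ⥤ ChainComplex (ModuleCat.{u} A) ℕ :=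
  tensorComplex (projectiveResolution (ModuleCat.of A (IsLocalRing.ResidueField A))).complex

instance (i : ℕ) : Module.Flat A
    ((projectiveResolution (ModuleCat.of A (IsLocalRing.ResidueField A))).complex.X i) := by
  have : Projective
    ((projectiveResolution (ModuleCat.of A (IsLocalRing.ResidueField A))).complex.X i) :=
    inferInstance
  have := (IsProjective.iff_projective (R := A) _).2 this
  infer_instance

/-- `Tor_i(M, κ)` as the homology of `residueTensorComplex`. -/
def torIsoHomology (M : ModuleCat.{u} A) (i : ℕ) :
    torResidueField A M i ≅ (residueTensorComplex.obj M).homology i :=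
  ProjectiveResolution.isoLeftDerivedObj _ _ i

lemma smul_homology_eq_zero (M : ModuleCat.{u} A) (i : ℕ) (r : A)
    (hr : r ∈ IsLocalRing.maximalIdeal A) (x : (residueTensorComplex.obj M).homology i) :
    r • x = 0 := by
  have h : r • (torIsoHomology M i).inv.hom x = 0 :=
    let h := tor_residueField_isTorsionBySet M i
    @h _ ⟨r, hr⟩
  have h2 := congrArg (torIsoHomology M i).hom.hom h
  rw [map_smul, map_zero] at h2
  rwa [Iso.inv_hom_id_apply] at h2

-- A scalar of `I` occurring in `f x` can be moved across the tensor product and through `g` into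
-- `H`, where it acts as zero.
omit [IsLocalRing A] in
lemma comp_rTensor_eq_zero {K F P H : Type*} [AddCommGroup K] [AddCommGroup F] [AddCommGroup P]
    [AddCommGroup H] [Module A K] [Module A F] [Module A P] [Module A H] (I : Ideal A)
    (f : K →ₗ[A] F) (hf : ∀ x, f x ∈ (I • ⊤ : Submodule A F)) (g : F ⊗[A] P →ₗ[A] H)
    (hH : ∀ r ∈ I, ∀ x : H, r • x = 0) : g ∘ₗ f.rTensor P = 0 := by
  ext k p
  change g (f k ⊗ₜ p) = 0
  generalize f k = v, hf k = hv
  induction hv using Submodule.smul_induction_on' with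
  | smul r hr n hn => rw [← TensorProduct.smul_tmul', map_smul, hH r hr]
  | add a ha b hb h1 h2 => rw [TensorProduct.add_tmul, map_add, h1, h2, add_zero]

/-- The image of `f` lies in `𝔪 F`, and `𝔪` kills `Tor_0(F, κ)`. In degree 0 every chain is a cycle,
so the claim can be checked on chains. -/
lemma torMap_zero_eq_zero {K F : ModuleCat.{u} A} (f : K ⟶ F)
    (hf : ∀ x, f.hom x ∈ (IsLocalRing.maximalIdeal A • ⊤ : Submodule A F)) :
    HomologicalComplex.homologyMap (residueTensorComplex.map f) 0 = 0 := by
  set C := residueTensorComplex (A := A)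
  rw [← cancel_epi ((C.obj K).homologyπ 0), HomologicalComplex.homologyπ_naturality, comp_zero]
  have h0 : (C.obj F).d 0 ((ComplexShape.down ℕ).next 0) = 0 :=
    (C.obj F).shape _ _ (by simp)
  have : IsIso ((C.obj F).iCycles 0) := (C.obj F).isIso_iCycles _ _ rfl h0
  have key : ∀ y, ((inv ((C.obj F).iCycles 0) ≫ (C.obj F).homologyπ 0).hom
      (((C.map f).f 0).hom y)) = 0 := by
    intro y
    exact LinearMap.congr_fun (comp_rTensor_eq_zero (IsLocalRing.maximalIdeal A) f.hom hf
      (inv ((C.obj F).iCycles 0) ≫ (C.obj F).homologyπ 0).hom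
      fun r hr x => smul_homology_eq_zero F 0 r hr x) y
  rw [show HomologicalComplex.cyclesMap (C.map f) 0 = (C.obj K).iCycles 0 ≫ (C.map f).f 0 ≫
    inv ((C.obj F).iCycles 0) by
      rw [← Category.assoc, IsIso.eq_comp_inv, HomologicalComplex.cyclesMap_i]]
  ext x
  simpa using key (((C.obj K).iCycles 0).hom x)

variable {S : ShortComplex (ModuleCat.{u} A)} (hS : S.ShortExact)
  (hm : ∀ x, S.f.hom x ∈ (IsLocalRing.maximalIdeal A • ⊤ : Submodule A S.X₂))

/-- An `A`-linear isomorphism of vector spaces over `κ` is linear over `κ`. -/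
def residueFieldEquiv {V W : Type u} [AddCommGroup V] [AddCommGroup W] [Module A V]
    [Module A W] [Module (IsLocalRing.ResidueField A) V] [Module (IsLocalRing.ResidueField A) W]
    (hV : ∀ (r : A) (v : V), IsLocalRing.residue A r • v = r • v)
    (hW : ∀ (r : A) (v : W), IsLocalRing.residue A r • v = r • v) (e : V ≃ₗ[A] W) :
    V ≃ₗ[IsLocalRing.ResidueField A] W where
  __ := e
  map_smul' c x := by
    obtain ⟨r, rfl⟩ := IsLocalRing.residue_surjective c
    simp [hV, hW]

/-- `Tor_0(M, κ)` is `κ ⊗ M`. -/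
def torZeroEquiv (M : ModuleCat.{u} A) :
    torResidueField A M 0 ≃ₗ[IsLocalRing.ResidueField A] IsLocalRing.ResidueField A ⊗[A] M :=
  have : PreservesFiniteColimits ((tensoringLeft (ModuleCat.{u} A)).obj M) :=
    inferInstanceAs (PreservesFiniteColimits (tensorLeft M))
  residueFieldEquiv (fun _ _ => rfl) (fun r v => algebraMap_smul _ r v)
    ((((tensoringLeft (ModuleCat.{u} A)).obj M).leftDerivedZeroIsoSelf.app
    (ModuleCat.of A (IsLocalRing.ResidueField A))).toLinearEquiv ≪≫ₗ
    (TensorProduct.comm A M (IsLocalRing.ResidueField A)))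

include hS hm

/-- Right exactness gives a surjection from the middle term; its kernel is the image of `Tor_0(S.X₁,
κ)`, which is zero by minimality. -/
lemma nonempty_tor_zero_iso : Nonempty (torResidueField A S.X₃ 0 ≅ torResidueField A S.X₂ 0) := by
  have h := shortExact_tensorComplex hS
    (projectiveResolution (ModuleCat.of A (IsLocalRing.ResidueField A))).complex
  have h1 := h.homology_exact₂ 0
  let φ : (residueTensorComplex.{u}.obj S.X₂).homology 0 ⟶
    (residueTensorComplex.{u}.obj S.X₃).homology 0 :=
    HomologicalComplex.homologyMap (residueTensorComplex.{u}.map S.g) 0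
  have : Epi φ := by
    have : Epi (residueTensorComplex.{u}.map S.g) := h.epi_g
    exact HomologicalComplex.epi_homologyMap_of_epi_of_not_rel _ _ (by simp)
  have : Mono φ := h1.mono_g (torMap_zero_eq_zero S.f hm)
  have : IsIso φ := isIso_of_mono_of_epi _
  exact ⟨torIsoHomology _ 0 ≪≫ (asIso φ).symm ≪≫ (torIsoHomology _ 0).symm⟩

/-- The connecting map is injective since higher Tor of the flat middle term vanishes. It is
surjective for the same reason when `i > 0`, and by minimality when `i = 0`. -/
lemma nonempty_tor_succ_iso [Module.Flat A S.X₂] (i : ℕ) :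
    Nonempty (torResidueField A S.X₃ (i + 1) ≅ torResidueField A S.X₁ i) := by
  have h := shortExact_tensorComplex hS
    (projectiveResolution (ModuleCat.of A (IsLocalRing.ResidueField A))).complex
  have hi : (ComplexShape.down ℕ).Rel (i + 1) i := by simp
  have : Mono (h.δ (i + 1) i hi) := h.mono_δ _ _ hi (isZero_homology_tensorComplex _ _ _)
  have : Epi (h.δ (i + 1) i hi) := by
    cases i with
    | zero => exact (h.homology_exact₁ _ _ hi).epi_f (torMap_zero_eq_zero S.f hm)
    | succ i => exact h.epi_δ _ _ hi (isZero_homology_tensorComplex _ _ _)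
  have : IsIso (h.δ (i + 1) i hi) := isIso_of_mono_of_epi _
  exact ⟨torIsoHomology _ _ ≪≫ @asIso _ _ _ _ (h.δ (i + 1) i hi) this ≪≫ (torIsoHomology _ _).symm⟩

lemma bettiNumber_zero_of_minimal [Module.Free A S.X₂] [Module.Finite A S.X₂] :
    Module.Finite (IsLocalRing.ResidueField A) (torResidueField A S.X₃ 0) ∧
      bettiNumber A S.X₃ 0 = Module.finrank A S.X₂ := by
  obtain ⟨e⟩ := nonempty_tor_zero_iso hS hm
  have e' := (residueFieldEquiv (fun _ _ => rfl) (fun _ _ => rfl) e.toLinearEquiv).trans (torZeroEquiv S.X₂)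
  exact ⟨Module.Finite.equiv e'.symm, e'.finrank_eq.trans (Module.finrank_baseChange ..)⟩

lemma bettiNumber_succ_of_minimal [Module.Flat A S.X₂] (i : ℕ) :
    (Module.Finite (IsLocalRing.ResidueField A) (torResidueField A S.X₁ i) →
      Module.Finite (IsLocalRing.ResidueField A) (torResidueField A S.X₃ (i + 1))) ∧
      bettiNumber A S.X₃ (i + 1) = bettiNumber A S.X₁ i := by
  obtain ⟨e⟩ := nonempty_tor_succ_iso hS hm i
  have e' := residueFieldEquiv (fun _ _ => rfl) (fun _ _ => rfl) e.toLinearEquiv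
  exact ⟨fun h => Module.Finite.equiv e'.symm, e'.finrank_eq⟩

end BettiRecursion

universe u

/-! ### Minimal free resolutions over a local ring -/

section MinimalResolution

open TensorProduct

variable {A : Type u} [CommRing A] [IsLocalRing A]

/-- A resolution of a module over a local ring `A` whose differentials vanish modulo the maximal
ideal. -/
structure IsMinimalResolution {X : ℕ → Type u} [∀ i, AddCommGroup (X i)] [∀ i, Module A (X i)]
    {M : Type u} [AddCommGroup M] [Module A M] (d : ∀ i, X (i + 1) →ₗ[A] X i)
    (ε : X 0 →ₗ[A] M) : Prop where
  surjective : Function.Surjective ε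
  exact_zero : Function.Exact (d 0) ε
  exact_succ : ∀ i, Function.Exact (d (i + 1)) (d i)
  minimal : ∀ i x, d i x ∈ (IsLocalRing.maximalIdeal A • ⊤ : Submodule A (X i))

/-- Dimension shifting: the truncated resolution resolves the first syzygy, which drives the
induction in `IsMinimalResolution.bettiNumber_eq`. -/
lemma IsMinimalResolution.shift {X : ℕ → Type u} [∀ i, AddCommGroup (X i)] [∀ i, Module A (X i)]
    {M : Type u} [AddCommGroup M] [Module A M] {d : ∀ i, X (i + 1) →ₗ[A] X i}
    {ε : X 0 →ₗ[A] M} (h : IsMinimalResolution d ε) :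
    IsMinimalResolution (X := fun i => X (i + 1)) (fun i => d (i + 1))
      ((d 0).codRestrict (LinearMap.ker ε) fun x => (h.exact_zero _).2 ⟨x, rfl⟩) where
  surjective := by
    rintro ⟨x, hx⟩
    obtain ⟨y, rfl⟩ := (h.exact_zero _).1 hx
    exact ⟨y, rfl⟩
  exact_zero x := by
    rw [← h.exact_succ 0 x, Subtype.ext_iff]
    rfl
  exact_succ i := h.exact_succ (i + 1)
  minimal i := h.minimal (i + 1)

omit [IsLocalRing A] in
lemma shortExact_ker {X M : Type u} [AddCommGroup X] [Module A X] [AddCommGroup M] [Module A M]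
    (ε : X →ₗ[A] M) (h : Function.Surjective ε) :
    (ShortComplex.mk (ModuleCat.ofHom (LinearMap.ker ε).subtype) (ModuleCat.ofHom ε)
      (by ext x; exact x.2)).ShortExact where
  exact := by
    rw [ShortComplex.moduleCat_exact_iff]
    intro x hx
    exact ⟨⟨x, hx⟩, rfl⟩
  mono_f := by
    rw [ModuleCat.mono_iff_injective]
    exact Subtype.val_injective
  epi_g := by
    rw [ModuleCat.epi_iff_surjective]
    exact h

/-- The Betti numbers of a module are the ranks in a minimal free resolution. -/
theorem IsMinimalResolution.bettiNumber_eq (i : ℕ) {X : ℕ → Type u} [∀ i, AddCommGroup (X i)]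
    [∀ i, Module A (X i)] [∀ i, Module.Free A (X i)] [∀ i, Module.Finite A (X i)]
    {M : Type u} [AddCommGroup M] [Module A M] {d : ∀ i, X (i + 1) →ₗ[A] X i}
    {ε : X 0 →ₗ[A] M} (h : IsMinimalResolution d ε) :
    Module.Finite (IsLocalRing.ResidueField A) (torResidueField A (ModuleCat.of A M) i) ∧
      bettiNumber A (ModuleCat.of A M) i = Module.finrank A (X i) := by
  have hm : ∀ x : LinearMap.ker ε, x.1 ∈ (IsLocalRing.maximalIdeal A • ⊤ : Submodule A (X 0)) := by
    rintro ⟨x, hx⟩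
    obtain ⟨y, rfl⟩ := (h.exact_zero _).1 hx
    exact h.minimal 0 y
  have : Module.Free A (ModuleCat.of A (X 0)) := inferInstanceAs (Module.Free A (X 0))
  have : Module.Finite A (ModuleCat.of A (X 0)) := inferInstanceAs (Module.Finite A (X 0))
  induction i generalizing X M with
  | zero => exact bettiNumber_zero_of_minimal (shortExact_ker ε h.surjective) hm
  | succ i ih =>
    have h1 := bettiNumber_succ_of_minimal (shortExact_ker ε h.surjective) hm i
    have h2 := ih h.shift (by
      rintro ⟨x, hx⟩
      obtain ⟨y, rfl⟩ := (h.shift.exact_zero _).1 hx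
      exact h.shift.minimal 0 y) (inferInstanceAs (Module.Free A (X 1)))
      (inferInstanceAs (Module.Finite A (X 1)))
    exact ⟨h1.1 h2.1, h1.2.trans h2.2⟩

omit [IsLocalRing A] in
lemma mem_smul_top_pi {ι : Type*} [Fintype ι] {N : ι → Type*} [∀ i, AddCommGroup (N i)]
    [∀ i, Module A (N i)] (I : Ideal A) (x : ∀ i, N i)
    (h : ∀ i, x i ∈ (I • ⊤ : Submodule A (N i))) : x ∈ (I • ⊤ : Submodule A (∀ i, N i)) := by
  classical
  rw [← Finset.univ_sum_single x]
  refine Submodule.sum_mem _ fun i _ => ?_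
  have h1 := Submodule.mem_map_of_mem (f := LinearMap.single A N i) (h i)
  rw [Submodule.map_smul''] at h1
  exact Submodule.smul_mono le_rfl le_top h1

/-- Lifts of a basis of `κ ⊗ M` generate `M` by Nakayama. A relation between them reduces to a
linear relation between basis vectors, so its coefficients lie in the maximal ideal. -/
lemma exists_minimal_cover (M : Type u) [AddCommGroup M] [Module A M] [Module.Finite A M] :
    ∃ (n : ℕ) (f : (Fin n → A) →ₗ[A] M), Function.Surjective f ∧
      ∀ x, f x = 0 → x ∈ (IsLocalRing.maximalIdeal A • ⊤ : Submodule A (Fin n → A)) := by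
  let b := Module.finBasis (IsLocalRing.ResidueField A) (IsLocalRing.ResidueField A ⊗[A] M)
  have hs : Function.Surjective (TensorProduct.mk A (IsLocalRing.ResidueField A) M 1) :=
    TensorProduct.mk_surjective A M _ IsLocalRing.residue_surjective
  choose g hg using fun i => hs (b i)
  refine ⟨_, Fintype.linearCombination A g, ?_, fun x hx => ?_⟩
  · rw [← LinearMap.range_eq_top, Fintype.range_linearCombination]
    exact IsLocalRing.span_eq_top_of_tmul_eq_basis g b hg
  · refine mem_smul_top_pi _ _ fun i => ?_
    have h1 := congrArg (TensorProduct.mk A (IsLocalRing.ResidueField A) M 1) hx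
    rw [Fintype.linearCombination_apply, map_sum, map_zero] at h1
    simp only [map_smul, hg] at h1
    have h2 := Fintype.linearIndependent_iff.1 b.linearIndependent
      (fun i => IsLocalRing.residue A (x i)) (by
        rw [← h1]
        exact Finset.sum_congr rfl fun i _ => algebraMap_smul _ (x i) (b i)) i
    rw [IsLocalRing.residue_eq_zero_iff] at h2
    simpa using h2

-- Iterate `exists_minimal_cover` on successive kernels, which remain finite because the ring is
-- noetherian.
variable (A) in
theorem exists_minimalResolution [IsNoetherianRing A] (M : Type u) [AddCommGroup M] [Module A M]
    [Module.Finite A M] : ∃ (c : ℕ → ℕ) (d : ∀ i, (Fin (c (i + 1)) → A) →ₗ[A] (Fin (c i) → A))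
      (ε : (Fin (c 0) → A) →ₗ[A] M), IsMinimalResolution (X := fun i => Fin (c i) → A) d ε := by
  choose n f hf hf' using fun M : {M : ModuleCat.{u} A // Module.Finite A M} =>
    have := M.2
    exists_minimal_cover (A := A) M.1
  let next (M : {M : ModuleCat.{u} A // Module.Finite A M}) :
    {M : ModuleCat.{u} A // Module.Finite A M} :=
    ⟨ModuleCat.of A (LinearMap.ker (f M)), inferInstanceAs (Module.Finite A (LinearMap.ker (f M)))⟩
  let S : ℕ → {M : ModuleCat.{u} A // Module.Finite A M} := fun i =>
    Nat.rec ⟨ModuleCat.of A M, ‹_›⟩ (fun _ => next) i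
  let d (i : ℕ) : (Fin (n (S (i + 1))) → A) →ₗ[A] (Fin (n (S i)) → A) :=
    (LinearMap.ker (f (S i))).subtype ∘ₗ f (S (i + 1))
  have hd : ∀ i, Function.Exact (d i) (f (S i)) := fun i x =>
    ⟨fun hx => (hf (S (i + 1)) ⟨x, hx⟩).imp fun y hy => congrArg Subtype.val hy, by
      rintro ⟨y, rfl⟩
      exact (f (S (i + 1)) y).2⟩
  refine ⟨fun i => n (S i), d, f (S 0), hf (S 0), hd 0, fun i x => ?_, fun i x => hf' _ _ ?_⟩
  · rw [← hd (i + 1) x]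
    exact (Subtype.ext_iff (a1 := f (S (i + 1)) x) (a2 := 0)).symm
  · exact (hd i _).2 ⟨x, rfl⟩

end MinimalResolution

/-! ### The total complex of an augmented double complex -/

section TotalComplex

variable {A : Type u} [CommRing A]

/-- A first quadrant double complex with commuting differentials, and an augmentation of its
columns. -/
structure AugmentedDoubleComplex (B : ℕ → ℕ → Type u) [∀ p q, AddCommGroup (B p q)]
    [∀ p q, Module A (B p q)] (G : ℕ → Type u) [∀ p, AddCommGroup (G p)] [∀ p, Module A (G p)] where
  dv : ∀ p q, B p (q + 1) →ₗ[A] B p q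
  dh : ∀ p q, B (p + 1) q →ₗ[A] B p q
  e : ∀ p, B p 0 →ₗ[A] G p
  d : ∀ p, G (p + 1) →ₗ[A] G p
  comm : ∀ p q x, dv p q (dh p (q + 1) x) = dh p q (dv (p + 1) q x)
  dh_dh : ∀ p q x, dh p q (dh (p + 1) q x) = 0
  e_dh : ∀ p x, e p (dh p 0 x) = d p (e (p + 1) x)
  exact_dv : ∀ p q, Function.Exact (dv p (q + 1)) (dv p q)
  exact_e : ∀ p, Function.Exact (dv p 0) (e p)
  surjective_e : ∀ p, Function.Surjective (e p)

namespace AugmentedDoubleComplex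

variable {B : ℕ → ℕ → Type u} [∀ p q, AddCommGroup (B p q)]
    [∀ p q, Module A (B p q)] {G : ℕ → Type u} [∀ p, AddCommGroup (G p)] [∀ p, Module A (G p)]
    (K : AugmentedDoubleComplex (A := A) B G)

/-- The total differential. -/
def D : (∀ p q, B p q) →ₗ[A] (∀ p q, B p q) where
  toFun z p q := K.dv p q (z p (q + 1)) + (-1 : A) ^ q • K.dh p q (z (p + 1) q)
  map_add' x y := by
    funext p q
    simp only [Pi.add_apply, map_add, smul_add]
    abel
  map_smul' a x := by
    funext p q
    simp only [Pi.smul_apply, map_smul, smul_add, RingHom.id_apply, smul_comm _ a]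

lemma D_apply (z : ∀ p q, B p q) (p q : ℕ) :
    K.D z p q = K.dv p q (z p (q + 1)) + (-1 : A) ^ q • K.dh p q (z (p + 1) q) := rfl

lemma D_D (z : ∀ p q, B p q) : K.D (K.D z) = 0 := by
  funext p q
  have h : K.dv p q (K.dv p (q + 1) (z p (q + 1 + 1))) = 0 := (K.exact_dv p q _).2 ⟨_, rfl⟩
  simp only [D_apply, map_add, map_smul, h, K.dh_dh, K.comm, smul_zero, add_zero, zero_add, pow_succ,
    Pi.zero_apply]
  module

variable (A B) in
/-- The elements of total degree `n`. -/
def tot (n : ℕ) : Submodule A (∀ p q, B p q) where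
  carrier := {z | ∀ p q, p + q ≠ n → z p q = 0}
  add_mem' hx hy p q h := by simp [hx p q h, hy p q h]
  zero_mem' _ _ _ := rfl
  smul_mem' a x hx p q h := by simp [hx p q h]

lemma D_mem {n : ℕ} {z : ∀ p q, B p q} (hz : z ∈ tot A B (n + 1)) : K.D z ∈ tot A B n := by
  intro p q h
  rw [D_apply, hz p (q + 1) (by lia), hz (p + 1) q (by lia), map_zero, map_zero, smul_zero, add_zero]

/-- The element with a single nonzero component. -/
def single (p q : ℕ) : B p q →ₗ[A] (∀ p q, B p q) :=
  (LinearMap.single A (fun p => ∀ q, B p q) p) ∘ₗ (LinearMap.single A (B p) q)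

lemma single_same (p q : ℕ) (x : B p q) : single (A := A) p q x p q = x := by simp [single]

lemma single_of_ne (p q p' q' : ℕ) (x : B p q) (h : p' ≠ p ∨ q' ≠ q) :
    single (A := A) p q x p' q' = 0 := by
  by_cases hp : p' = p
  · subst hp
    simp [single, Pi.single_eq_of_ne (h.resolve_left (fun h => h rfl))]
  · simp [single, Pi.single_eq_of_ne hp]

lemma single_mem (p q : ℕ) (x : B p q) {n : ℕ} (h : p + q = n) :
    single (A := A) p q x ∈ tot A B n :=
  fun p' q' h' => single_of_ne p q p' q' x (by lia)

/-- The component of `z` in its last possibly nonzero column is a vertical cycle, hence a vertical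
boundary; subtracting a total boundary clears that column. The bound `k ≤ n` keeps away from
position `(n, 0)`, where the column is exact only up to the augmentation. -/
lemma exists_D_eq_of_vanishing {n k : ℕ} (hk : k ≤ n) (z : ∀ p q, B p q) (hz : z ∈ tot A B n)
    (hD : K.D z = 0) (h0 : ∀ p q, k ≤ p → z p q = 0) : ∃ w ∈ tot A B (n + 1), K.D w = z := by
  induction k generalizing z with
  | zero => exact ⟨0, zero_mem _, by rw [map_zero]; funext p q; exact (h0 p q (Nat.zero_le _)).symm⟩
  | succ k ih =>
    obtain ⟨q, rfl⟩ : ∃ q, n = k + (q + 1) := ⟨n - k - 1, by lia⟩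
    have h1 : K.dv k q (z k (q + 1)) = 0 := by
      have := congrFun (congrFun hD k) q
      rwa [D_apply, h0 (k + 1) q le_rfl, map_zero, smul_zero, add_zero] at this
    obtain ⟨w, hw⟩ := (K.exact_dv k q _).1 h1
    have hw' : single (A := A) k (q + 2) w ∈ tot A B (k + (q + 1) + 1) := single_mem _ _ _ (by lia)
    obtain ⟨w', hw'1, hw'2⟩ := ih (by lia) (z - K.D (single k (q + 2) w))
      (sub_mem hz (K.D_mem hw')) (by rw [map_sub, hD, D_D, sub_zero]) (by
        intro p q' hp
        simp only [Pi.sub_apply]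
        rw [D_apply, single_of_ne _ _ (p + 1) q' _ (by lia), map_zero, smul_zero, add_zero]
        by_cases h : p = k ∧ q' = q + 1
        · obtain ⟨rfl, rfl⟩ := h
          rw [single_same, hw, sub_self]
        · rw [single_of_ne _ _ p (q' + 1) _ (by lia), map_zero, sub_zero]
          by_cases hpk : p = k
          · exact hz _ _ (by lia)
          · exact h0 _ _ (by lia))
    exact ⟨w' + single k (q + 2) w, add_mem hw'1 hw', by rw [map_add, hw'2, sub_add_cancel]⟩

/-- The hypothesis on `K.e` handles the corner `(n, 0)`: a correction `x` at `(n + 1, 0)` moves the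
corner component into the kernel of the augmentation, and a vertical correction `y` at `(n, 1)` then
removes it. -/
lemma exists_D_eq {n : ℕ} (z : ∀ p q, B p q) (hz : z ∈ tot A B n)
    (hD : K.D z = 0) (he : K.e n (z n 0) ∈ LinearMap.range (K.d n)) :
    ∃ w ∈ tot A B (n + 1), K.D w = z := by
  obtain ⟨g, hg⟩ := he
  obtain ⟨x, rfl⟩ := K.surjective_e _ g
  have h1 : K.e n (z n 0 - K.dh n 0 x) = 0 := by rw [map_sub, K.e_dh, hg, sub_self]
  obtain ⟨y, hy⟩ := (K.exact_e n _).1 h1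
  have hx' : single (A := A) (n + 1) 0 x ∈ tot A B (n + 1) := single_mem _ _ _ (by lia)
  have hy' : single (A := A) n 1 y ∈ tot A B (n + 1) := single_mem _ _ _ (by lia)
  set v := single (A := A) (n + 1) 0 x + single (A := A) n 1 y
  have hv : v ∈ tot A B (n + 1) := add_mem hx' hy'
  obtain ⟨w, hw1, hw2⟩ := K.exists_D_eq_of_vanishing le_rfl (z - K.D v)
    (sub_mem hz (K.D_mem hv)) (by rw [map_sub, hD, D_D, sub_zero]) (by
      intro p q hp
      by_cases h : p + q = n
      · obtain ⟨rfl, rfl⟩ : p = n ∧ q = 0 := by lia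
        simp only [v, Pi.sub_apply, D_apply, Pi.add_apply]
        rw [single_same, single_same, single_of_ne _ _ p (0 + 1) _ (by lia),
          single_of_ne _ _ (p + 1) 0 _ (by lia), show (0 : B p (0 + 1)) + y = y from zero_add y, hy]
        simp
      · exact sub_mem hz (K.D_mem hv) p q h)
  exact ⟨w + v, add_mem hw1 hv, by rw [map_add, hw2, sub_add_cancel]⟩

variable (A B) in
/-- The elements of total degree `n` are families indexed by the antidiagonal. -/
def totEquiv (n : ℕ) :
    tot A B n ≃ₗ[A] (∀ x : Finset.HasAntidiagonal.antidiagonal n, B x.1.1 x.1.2) where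
  toFun z x := z.1 x.1.1 x.1.2
  map_add' _ _ := rfl
  map_smul' _ _ := rfl
  invFun f := ⟨fun p q => if h : (p, q) ∈ Finset.HasAntidiagonal.antidiagonal n then f ⟨(p, q), h⟩ else 0,
    fun p q h => by simp [h]⟩
  left_inv z := by
    ext p q
    by_cases h : p + q = n
    · simp [h]
    · simp [h, z.2 p q h]
  right_inv f := by
    funext ⟨x, hx⟩
    simp only [hx, dite_true]

/-- The total complex. -/
def totD (n : ℕ) : tot A B (n + 1) →ₗ[A] tot A B n :=
  K.D.restrict fun _ hz => K.D_mem hz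

/-- The augmentation of the total complex. -/
def totAug {M : Type u} [AddCommGroup M] [Module A M] (ε : G 0 →ₗ[A] M) : tot A B 0 →ₗ[A] M :=
  ε ∘ₗ K.e 0 ∘ₗ LinearMap.proj 0 ∘ₗ LinearMap.proj (φ := fun p => ∀ q, B p q) 0 ∘ₗ
    (tot A B 0).subtype

theorem isMinimalResolution_tot [IsLocalRing A] {M : Type u} [AddCommGroup M] [Module A M]
    (ε : G 0 →ₗ[A] M) (hε : Function.Surjective ε) (h0 : Function.Exact (K.d 0) ε)
    (h1 : ∀ i, Function.Exact (K.d (i + 1)) (K.d i))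
    (hv : ∀ p q x, K.dv p q x ∈ (IsLocalRing.maximalIdeal A • ⊤ : Submodule A (B p q)))
    (hh : ∀ p q x, K.dh p q x ∈ (IsLocalRing.maximalIdeal A • ⊤ : Submodule A (B p q))) :
    IsMinimalResolution (X := fun n => tot A B n) K.totD (K.totAug ε) where
  surjective m := by
    obtain ⟨g, rfl⟩ := hε m
    obtain ⟨x, rfl⟩ := K.surjective_e 0 g
    exact ⟨⟨single 0 0 x, single_mem _ _ _ rfl⟩, by simp [totAug, single_same]⟩
  exact_zero := by
    rintro ⟨z, hz⟩
    constructor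
    · intro h
      obtain ⟨w, hw, h⟩ := K.exists_D_eq z hz (by
        funext p q
        rw [D_apply, hz p (q + 1) (by lia), hz (p + 1) q (by lia)]
        simp) ((h0 _).1 h)
      exact ⟨⟨w, hw⟩, Subtype.ext h⟩
    · rintro ⟨⟨w, hw⟩, h⟩
      obtain rfl : K.D w = z := congrArg Subtype.val h
      change ε (K.e 0 (K.D w 0 0)) = 0
      rw [D_apply, map_add, map_smul, K.e_dh, (K.exact_e 0 _).2 ⟨_, rfl⟩, zero_add, map_smul,
        (h0 _).2 ⟨_, rfl⟩, smul_zero]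
  exact_succ n := by
    rintro ⟨z, hz⟩
    constructor
    · intro h
      have hD : K.D z = 0 := congrArg Subtype.val h
      obtain ⟨w, hw, h⟩ := K.exists_D_eq z hz hD ((h1 n _).1 (by
        -- Augmenting the component `(n, 0)` of `K.D z = 0` shows that the augmented corner is a
        -- cycle of the complex `G`.
        have h2 := congrArg (K.e n) (congrFun (congrFun hD n) 0)
        rw [D_apply, map_add, map_smul, (K.exact_e n _).2 ⟨_, rfl⟩, K.e_dh] at h2
        simpa using h2))
      exact ⟨⟨w, hw⟩, Subtype.ext h⟩
    · rintro ⟨⟨w, hw⟩, h⟩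
      obtain rfl : K.D w = z := congrArg Subtype.val h
      exact Subtype.ext (K.D_D w)
  minimal n z := by
    -- Minimality is checked componentwise, which is legitimate because each total degree is a
    -- finite product.
    have h2 : totEquiv A B n (K.totD n z) ∈ (IsLocalRing.maximalIdeal A • ⊤ :
        Submodule A (∀ x : Finset.HasAntidiagonal.antidiagonal n, B x.1.1 x.1.2)) :=
      mem_smul_top_pi _ _ fun x => add_mem (hv _ _ _) (Submodule.smul_mem _ _ (hh _ _ _))
    have h3 := Submodule.mem_map_of_mem (f := (totEquiv A B n).symm.toLinearMap) h2
    rw [Submodule.map_smul''] at h3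
    have h4 := Submodule.smul_mono (I := IsLocalRing.maximalIdeal A) le_rfl le_top h3
    simpa using h4

end AugmentedDoubleComplex

end TotalComplex

/-! ### Change of rings for algebra retracts -/

section Retract

/-- Every finite module over a noetherian local ring has finite Betti numbers. -/
theorem hasFiniteBettiNumbers {A : Type u} [CommRing A] [IsLocalRing A] [IsNoetherianRing A]
    (M : Type u) [AddCommGroup M] [Module A M] [Module.Finite A M] :
    HasFiniteBettiNumbers A (ModuleCat.of A M) := fun i => by
  obtain ⟨c, d, ε, h⟩ := exists_minimalResolution A M
  exact (h.bettiNumber_eq i).1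

lemma exact_compLeft {A X Y Z : Type*} [CommRing A] [AddCommGroup X] [AddCommGroup Y]
    [AddCommGroup Z] [Module A X] [Module A Y] [Module A Z] {f : X →ₗ[A] Y} {g : Y →ₗ[A] Z}
    (h : Function.Exact f g) (I : Type*) : Function.Exact (f.compLeft I) (g.compLeft I) := by
  intro y
  constructor
  · intro hy
    choose x hx using fun i => (h (y i)).1 (congrFun hy i)
    exact ⟨x, funext hx⟩
  · rintro ⟨x, rfl⟩
    funext i
    exact (h _).2 ⟨_, rfl⟩

/-- The action of a matrix on columns with entries in a module. -/
def columnMap {A : Type*} [CommRing A] {m n : ℕ} (C : Fin m → Fin n → A) (N : Type*)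
    [AddCommGroup N] [Module A N] : (Fin n → N) →ₗ[A] (Fin m → N) :=
  LinearMap.pi fun i => ∑ j, C i j • LinearMap.proj j

lemma columnMap_apply {A : Type*} [CommRing A] {m n : ℕ} (C : Fin m → Fin n → A) {N : Type*}
    [AddCommGroup N] [Module A N] (v : Fin n → N) (i : Fin m) :
    columnMap C N v i = ∑ j, C i j • v j := by
  simp [columnMap]

lemma apply_eq_sum {R : Type*} [CommRing R] {m n : ℕ} (d : (Fin n → R) →ₗ[R] (Fin m → R))
    (v : Fin n → R) (i : Fin m) : d v i = ∑ j, d (Pi.single j 1) i * v j := by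
  conv_lhs => rw [← LinearMap.toMatrix'_mulVec d v]
  simp [Matrix.mulVec, dotProduct, LinearMap.toMatrix'_apply]

variable {A R : Type u} [CommRing A] [IsLocalRing A] [CommRing R]
  [IsLocalRing R] [IsNoetherianRing R] [Algebra A R] (s : R →+* A)
  (hs : ∀ r, algebraMap A R (s r) = r)
include hs

-- If `s r` were a unit, so would be its image `r` in `R`. This makes the lifted matrices minimal.
omit [IsNoetherianRing R] in
lemma section_mem_maximalIdeal {r : R} (hr : r ∈ IsLocalRing.maximalIdeal R) :
    s r ∈ IsLocalRing.maximalIdeal A := by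
  rw [IsLocalRing.mem_maximalIdeal, mem_nonunits_iff] at *
  intro h
  exact hr (by simpa [hs] using h.map (algebraMap A R))

/-- Change of rings for an algebra retract: if `A → R` has a section, then
`P^A_M = P^R_M * P^A_R` for every finite `R`-module `M`. -/
theorem poincareSeries_of_section [IsNoetherianRing A] (M : Type u) [AddCommGroup M] [Module A M]
    [Module R M] [IsScalarTower A R M] [Module.Finite R M] :
    poincareSeries A (ModuleCat.of A M) =
      poincareSeries R (ModuleCat.of R M) * poincareSeries A (ModuleCat.of A R) := by
  have : Module.Finite A R := Module.Finite.of_surjective (Algebra.linearMap A R)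
    fun r => ⟨s r, hs r⟩
  obtain ⟨c, d, ε, h⟩ := exists_minimalResolution R M
  obtain ⟨y, d', ε', h'⟩ := exists_minimalResolution A R
  -- The matrices of the `R`-resolution, lifted entrywise. Since `s` is a ring homomorphism,
  -- consecutive lifts still compose to zero (`hCC`), which arbitrary lifts need not do.
  let C (p : ℕ) (i : Fin (c p)) (j : Fin (c (p + 1))) : A := s (d p (Pi.single j 1) i)
  have hC : ∀ p (v : Fin (c (p + 1)) → R), columnMap (C p) R v = d p v := fun p v => by
    funext i
    rw [columnMap_apply, apply_eq_sum]
    exact Finset.sum_congr rfl fun j _ => by rw [Algebra.smul_def, hs]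
  have hCC : ∀ p i k, ∑ j, C p i j * C (p + 1) j k = 0 := fun p i k => by
    have := congrFun ((h.exact_succ p (d (p + 1) (Pi.single k 1))).2 ⟨_, rfl⟩) i
    rw [apply_eq_sum] at this
    simp only [C, ← map_mul, ← map_sum, this, Pi.zero_apply, map_zero]
  -- Column `p` is the `A`-resolution of `R` repeated `c p` times, so it resolves `R ^ c p`; on
  -- these augmentations the rows induce the original differentials `d p`.
  let K : AugmentedDoubleComplex (A := A) (fun p q => Fin (c p) → Fin (y q) → A)
      (fun p => Fin (c p) → R) :=
    { dv := fun p q => (d' q).compLeft _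
      dh := fun p q => columnMap (C p) _
      e := fun p => ε'.compLeft _
      d := fun p => (d p).restrictScalars A
      comm := fun p q x => by
        funext i
        simp [columnMap_apply]
      dh_dh := fun p q x => by
        funext i
        simp only [columnMap_apply, Finset.smul_sum, smul_smul]
        rw [Finset.sum_comm]
        simp only [← Finset.sum_smul, hCC, zero_smul, Finset.sum_const_zero, Pi.zero_apply]
      e_dh := fun p x => by
        refine Eq.trans ?_ (hC p _)
        funext i
        simp [columnMap_apply]
      exact_dv := fun p q => exact_compLeft (h'.exact_succ q) _
      exact_e := fun p => exact_compLeft h'.exact_zero _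
      surjective_e := fun p => h'.surjective.comp_left }
  have hK := K.isMinimalResolution_tot (ε.restrictScalars A) h.surjective h.exact_zero
    h.exact_succ (fun p q x => mem_smul_top_pi _ _ fun i => h'.minimal q (x i))
    (fun p q x => mem_smul_top_pi _ _ fun i => by
      change columnMap (C p) _ x i ∈ _
      rw [columnMap_apply]
      refine Submodule.sum_mem _ fun j _ =>
        Submodule.smul_mem_smul (section_mem_maximalIdeal s hs ?_) trivial
      have h1 := Submodule.mem_map_of_mem (f := LinearMap.proj (R := R) (φ := fun _ => R) i)
        (h.minimal p (Pi.single j 1))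
      rw [Submodule.map_smul''] at h1
      simpa using Submodule.smul_mono (I := IsLocalRing.maximalIdeal R) le_rfl le_top h1)
  have e (n : ℕ) := AugmentedDoubleComplex.totEquiv A (fun p q => Fin (c p) → Fin (y q) → A) n
  have (n : ℕ) : Module.Free A
      (AugmentedDoubleComplex.tot A (fun p q => Fin (c p) → Fin (y q) → A) n) :=
    Module.Free.of_equiv (e n).symm
  have (n : ℕ) : Module.Finite A
      (AugmentedDoubleComplex.tot A (fun p q => Fin (c p) → Fin (y q) → A) n) :=
    Module.Finite.equiv (e n).symm
  ext n
  rw [PowerSeries.coeff_mul]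
  simp only [poincareSeries, PowerSeries.coeff_mk]
  rw [(hK.bettiNumber_eq n).2, (e n).finrank_eq, Module.finrank_pi_fintype, Nat.cast_sum]
  refine Eq.trans ?_ (Finset.sum_coe_sort (Finset.HasAntidiagonal.antidiagonal n) fun x : ℕ × ℕ =>
    (bettiNumber R (ModuleCat.of R M) x.1 : ℤ) * (bettiNumber A (ModuleCat.of A R) x.2 : ℤ))
  refine Finset.sum_congr rfl fun x _ => ?_
  rw [(h.bettiNumber_eq _).2, (h'.bettiNumber_eq _).2]
  simp [Module.finrank_pi_fintype]

end Retract

/-! ### Poincaré series over a fibre product of rings -/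

section FibreProduct

/-- The Poincaré series of a module only depends on its isomorphism class. -/
lemma poincareSeries_congr {A : Type u} [CommRing A] [IsLocalRing A] {M N : ModuleCat.{u} A}
    (e : M ≅ N) : poincareSeries A M = poincareSeries A N := by
  ext i
  simp only [poincareSeries, PowerSeries.coeff_mk, bettiNumber]
  rw [(residueFieldEquiv (V := torResidueField A M i) (W := torResidueField A N i)
    (fun _ _ => rfl) (fun _ _ => rfl)
    (((Tor (ModuleCat.{u} A) i).mapIso e).app _).toLinearEquiv).finrank_eq]

/-- The ring `T` as a module over `A`, through `φ`. -/
abbrev ringModule {A T : Type u} [CommRing A] [CommRing T] (φ : A →+* T) : ModuleCat.{u} A :=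
  (ModuleCat.restrictScalars φ).obj (ModuleCat.of T T)

variable {A R S T : Type u} [CommRing A] [CommRing R] [CommRing S] [CommRing T]
  [IsLocalRing A] [IsLocalRing R]

lemma hasFiniteBettiNumbers_of_surjective [IsNoetherianRing A] (φ : A →+* T)
    (hφ : Function.Surjective φ) : HasFiniteBettiNumbers A (ringModule φ) := by
  algebraize [φ]
  have : Module.Finite A T := Module.Finite.of_surjective (Algebra.linearMap A T) hφ
  exact hasFiniteBettiNumbers (A := A) T

/-- `P_{A/J} = 1 + τ P_J`. -/
lemma poincareSeries_ringModule [Nontrivial T] (φ : A →+* T) (hφ : Function.Surjective φ) :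
    poincareSeries A (ringModule φ) =
      1 + PowerSeries.X * poincareSeries A (ModuleCat.of A (RingHom.ker φ)) := by
  algebraize [φ]
  -- As `T` is nontrivial the kernel is a proper ideal, so `A → T` is a minimal cover.
  have hm : ∀ x : LinearMap.ker (Algebra.linearMap A T),
      x.1 ∈ (IsLocalRing.maximalIdeal A • ⊤ : Submodule A A) := fun x => by
    simp only [smul_eq_mul, Ideal.mul_top]
    exact IsLocalRing.le_maximalIdeal (RingHom.ker_ne_top φ) x.2
  have h := shortExact_ker (Algebra.linearMap A T) hφ
  have : Module.Free A (ModuleCat.of A A) := inferInstanceAs (Module.Free A A)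
  have : Module.Finite A (ModuleCat.of A A) := inferInstanceAs (Module.Finite A A)
  ext i
  cases i with
  | zero =>
    simp only [poincareSeries, PowerSeries.coeff_mk]
    have h1 := (bettiNumber_zero_of_minimal h hm).2
    refine (congrArg Nat.cast h1).trans ?_
    simp
  | succ i =>
    rw [map_add, PowerSeries.coeff_succ_X_mul, PowerSeries.coeff_one, if_neg (by simp), zero_add]
    simp only [poincareSeries, PowerSeries.coeff_mk]
    exact congrArg Nat.cast (bettiNumber_succ_of_minimal h hm i).2

-- Along a surjection `A → R`, the `A`-submodules of `R` are its ideals; the identity, seen as a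
-- semilinear bijection, transports the chain condition.
omit [IsLocalRing A] [IsLocalRing R] in
lemma isNoetherian_of_surjective_algebraMap [Algebra A R] [IsNoetherianRing R]
    (h : Function.Surjective (algebraMap A R)) : IsNoetherian A R := by
  have : RingHomSurjective (algebraMap A R) := ⟨h⟩
  let l : R →ₛₗ[algebraMap A R] R :=
    { toFun := id
      map_add' := fun _ _ => rfl
      map_smul' := fun a x => Algebra.smul_def a x }
  exact (l.isNoetherian_iff_of_bijective Function.bijective_id).2 inferInstance

/-- `A` is the fibre product of two copies of `R` over `S`. -/
structure IsFibreProduct (p₁ p₂ : A →+* R) (σ : R →+* S) : Prop where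
  comm : ∀ a, σ (p₁ a) = σ (p₂ a)
  ext : ∀ a b, p₁ a = p₁ b → p₂ a = p₂ b → a = b
  exists_eq : ∀ r r', σ r = σ r' → ∃ a, p₁ a = r ∧ p₂ a = r'

namespace IsFibreProduct

variable {p₁ p₂ : A →+* R} {σ : R →+* S} (h : IsFibreProduct p₁ p₂ σ)
include h

omit [IsLocalRing A] [IsLocalRing R] in
lemma symm : IsFibreProduct p₂ p₁ σ where
  comm a := (h.comm a).symm
  ext a b h₁ h₂ := h.ext a b h₂ h₁
  exists_eq r r' hr := (h.exists_eq r' r hr.symm).imp fun _ => And.symm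

-- The diagonal: uniqueness of elements with given projections forces it to be a ring homomorphism.
omit [IsLocalRing A] [IsLocalRing R] in
lemma exists_section : ∃ s : R →+* A, (∀ r, p₁ (s r) = r) ∧ ∀ r, p₂ (s r) = r := by
  choose s h₁ h₂ using fun r => h.exists_eq r r rfl
  exact ⟨{
    toFun := s
    map_one' := h.ext _ _ (by simp [h₁]) (by simp [h₂])
    map_mul' := fun x y => h.ext _ _ (by simp [h₁]) (by simp [h₂])
    map_zero' := h.ext _ _ (by simp [h₁]) (by simp [h₂])
    map_add' := fun x y => h.ext _ _ (by simp [h₁]) (by simp [h₂]) }, h₁, h₂⟩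

-- `A` embeds as an `A`-module in `R × R`, with `A` acting through the two projections.
omit [IsLocalRing A] [IsLocalRing R] in
lemma isNoetherianRing [IsNoetherianRing R] : IsNoetherianRing A := by
  obtain ⟨s, h₁, h₂⟩ := h.exists_section
  have n₁ : IsNoetherian A (ringModule p₁) :=
    let := p₁.toAlgebra
    isNoetherian_of_surjective_algebraMap (A := A) (R := R) fun r => ⟨s r, h₁ r⟩
  have n₂ : IsNoetherian A (ringModule p₂) :=
    let := p₂.toAlgebra
    isNoetherian_of_surjective_algebraMap (A := A) (R := R) fun r => ⟨s r, h₂ r⟩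
  let l : A →ₗ[A] ringModule p₁ × ringModule p₂ :=
    { toFun := fun a => (p₁ a, p₂ a)
      map_add' := fun a b => by simp; rfl
      map_smul' := fun a b => by simp; rfl }
  exact isNoetherian_of_injective l fun a b hab =>
    h.ext a b (congrArg Prod.fst hab) (congrArg Prod.snd hab)

/-- `p₂` maps `ker p₁` isomorphically onto `ker σ`, to which the retract formula along `p₂` applies.
The projection therefore switches from `p₁` to `p₂`. -/
lemma poincareSeries_ker [IsNoetherianRing R] :
    poincareSeries A (ModuleCat.of A (RingHom.ker p₁)) =
      poincareSeries R (ModuleCat.of R (RingHom.ker σ)) * poincareSeries A (ringModule p₂) := by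
  obtain ⟨s, h₁, h₂⟩ := h.exists_section
  have := h.isNoetherianRing
  algebraize [p₂]
  let : Module A (RingHom.ker σ) := Module.compHom _ p₂
  have : IsScalarTower A R (RingHom.ker σ) := ⟨fun a r x => by
    rw [Algebra.smul_def, mul_smul]; rfl⟩
  refine Eq.trans ?_ (poincareSeries_of_section s h₂ (RingHom.ker σ))
  let l : RingHom.ker p₁ →ₗ[A] RingHom.ker σ :=
    { toFun := fun a => ⟨p₂ a, by rw [RingHom.mem_ker, ← h.comm, (RingHom.mem_ker).1 a.2, map_zero]⟩
      map_add' := fun a b => Subtype.ext (map_add p₂ a.1 b.1)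
      map_smul' := fun a b => Subtype.ext (map_mul p₂ a b.1) }
  refine poincareSeries_congr (LinearEquiv.ofBijective l ⟨fun a b hab => ?_, fun x => ?_⟩).toModuleIso
  · exact Subtype.ext (h.ext _ _ (((RingHom.mem_ker).1 a.2).trans ((RingHom.mem_ker).1 b.2).symm)
      (congrArg Subtype.val hab))
  · obtain ⟨a, ha₁, ha₂⟩ := h.exists_eq 0 x.1 (by rw [map_zero, (RingHom.mem_ker).1 x.2])
    exact ⟨⟨a, ha₁⟩, Subtype.ext ha₂⟩

lemma poincareSeries_ringModule_left [IsNoetherianRing R] [Nontrivial S]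
    (hσ : Function.Surjective σ) :
    poincareSeries A (ringModule p₁) * (2 - poincareSeries R (ringModule σ)) = 1 := by
  obtain ⟨s, h₁, h₂⟩ := h.exists_section
  have e₁ := poincareSeries_ringModule p₁ fun r => ⟨s r, h₁ r⟩
  have e₂ := poincareSeries_ringModule p₂ fun r => ⟨s r, h₂ r⟩
  rw [h.poincareSeries_ker] at e₁
  rw [h.symm.poincareSeries_ker] at e₂
  rw [poincareSeries_ringModule σ hσ]
  set Q₁ := poincareSeries A (ringModule p₁)
  set Q₂ := poincareSeries A (ringModule p₂)
  set P := poincareSeries R (ModuleCat.of R (RingHom.ker σ))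
  -- Subtracting the two recursions gives `(1 + τ P)(Q₁ - Q₂) = 0`, and `ℤ⟦τ⟧` is a domain.
  have hu : (1 + PowerSeries.X * P : PowerSeries ℤ) ≠ 0 := fun h0 => by
    have := congrArg (PowerSeries.constantCoeff (R := ℤ)) h0
    simp at this
  have hQ : Q₁ = Q₂ := by
    refine sub_eq_zero.1 ((mul_eq_zero.1 (?_ : (1 + PowerSeries.X * P) * (Q₁ - Q₂) = 0)).resolve_left
      hu)
    linear_combination e₁ - e₂
  linear_combination e₁ - PowerSeries.X * P * hQ

/-- The Poincaré series over a fibre product `R ×_S R` of a quotient of `R`. -/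
theorem poincareSeries_comp [IsNoetherianRing R] [Nontrivial S] (hσ : Function.Surjective σ)
    (ω : R →+* T) (hω : Function.Surjective ω) :
    HasFiniteBettiNumbers A (ringModule (ω.comp p₁)) ∧
    poincareSeries A (ringModule (ω.comp p₁)) * (2 - poincareSeries R (ringModule σ)) =
      poincareSeries R (ringModule ω) := by
  obtain ⟨s, h₁, h₂⟩ := h.exists_section
  have := h.isNoetherianRing
  refine ⟨hasFiniteBettiNumbers_of_surjective _ (hω.comp fun r => ⟨s r, h₁ r⟩), ?_⟩
  have e : poincareSeries A (ringModule (ω.comp p₁)) =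
      poincareSeries R (ringModule ω) * poincareSeries A (ringModule p₁) := by
    let := p₁.toAlgebra
    let := ω.toAlgebra
    let := (ω.comp p₁).toAlgebra
    have : IsScalarTower A R T := .of_algebraMap_eq fun _ => rfl
    have : Module.Finite R T := Module.Finite.of_surjective (Algebra.linearMap R T) hω
    exact poincareSeries_of_section s h₁ T
  rw [e, mul_assoc, h.poincareSeries_ringModule_left hσ, mul_one]

end IsFibreProduct

end FibreProduct

/-! ### Weighted norms on power series and the ring of convergent series -/

section ConvergentSeries

open scoped ENNReal

variable {n : ℕ}

/-- The exponent `α` encoded as the product of the powers `pᵢ ^ αᵢ`, with `pᵢ` the `i`-th prime. -/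
def primeWeight (α : Fin n →₀ ℕ) : ℕ :=
  (α.embDomain (Fin.valEmbedding.trans
    ⟨Nat.nth Nat.Prime, Nat.nth_injective Nat.infinite_setOfPred_prime⟩)).prod (· ^ ·)

lemma primeWeight_eq (α : Fin n →₀ ℕ) :
    primeWeight α = α.prod fun i k => Nat.nth Nat.Prime i ^ k :=
  Finsupp.prod_embDomain

lemma primeWeight_add (α β : Fin n →₀ ℕ) :
    primeWeight (α + β) = primeWeight α * primeWeight β := by
  simp only [primeWeight_eq]
  exact Finsupp.prod_add_index' (fun _ => pow_zero _) fun _ _ _ => pow_add _ _ _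

lemma primeWeight_pos (α : Fin n →₀ ℕ) : 0 < primeWeight α := by
  rw [primeWeight_eq]
  exact Finset.prod_pos fun i _ => pow_pos (Nat.prime_nth_prime i).pos _

/-- Unique factorization. Hence `primeWeight` totally orders the exponents, compatibly with addition
and with finitely many below each one. -/
lemma primeWeight_injective : Function.Injective (primeWeight (n := n)) := by
  intro α β h
  have hf : ∀ γ : Fin n →₀ ℕ, (primeWeight γ).factorization = γ.embDomain (Fin.valEmbedding.trans
      ⟨Nat.nth Nat.Prime, Nat.nth_injective Nat.infinite_setOfPred_prime⟩) := fun γ => by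
    refine Nat.prod_pow_factorization_eq_self fun p hp => ?_
    rw [Finsupp.support_embDomain, Finset.mem_map] at hp
    obtain ⟨i, -, rfl⟩ := hp
    exact Nat.prime_nth_prime i
  exact Finsupp.embDomain_injective _ ((hf α).symm.trans ((congrArg _ h).trans (hf β)))

/-- The weight of the exponent `α` in the norm with parameter `s`. -/
def weight (s : ℕ) (α : Fin n →₀ ℕ) : ℝ≥0∞ := ((primeWeight α : ℝ≥0∞)⁻¹) ^ s

lemma weight_add (s : ℕ) (α β : Fin n →₀ ℕ) : weight s (α + β) = weight s α * weight s β := by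
  rw [weight, primeWeight_add, Nat.cast_mul, ENNReal.mul_inv (by simp) (by simp), mul_pow]
  rfl

lemma weight_ne_zero (s : ℕ) (α : Fin n →₀ ℕ) : weight s α ≠ 0 :=
  pow_ne_zero _ (by simp)

lemma weight_ne_top (s : ℕ) (α : Fin n →₀ ℕ) : weight s α ≠ ∞ :=
  ENNReal.pow_ne_top (by simpa using (primeWeight_pos α).ne')

lemma weight_anti {s t : ℕ} (h : s ≤ t) (α : Fin n →₀ ℕ) : weight t α ≤ weight s α := by
  refine pow_le_pow_right_of_le_one' ?_ h
  rw [ENNReal.inv_le_one]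
  exact_mod_cast primeWeight_pos α

/-- The weighted sum of the absolute values of the coefficients of a power series. -/
def wnorm (s : ℕ) (f : MvPowerSeries (Fin n) ℂ) : ℝ≥0∞ :=
  ∑' α, ‖MvPowerSeries.coeff α f‖ₑ * weight s α

lemma wnorm_add_le (s : ℕ) (f g : MvPowerSeries (Fin n) ℂ) :
    wnorm s (f + g) ≤ wnorm s f + wnorm s g := by
  rw [wnorm, wnorm, wnorm, ← ENNReal.tsum_add]
  refine ENNReal.tsum_le_tsum fun α => ?_
  rw [← add_mul, map_add]
  gcongr
  exact enorm_add_le _ _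

lemma wnorm_zero (s : ℕ) : wnorm s (0 : MvPowerSeries (Fin n) ℂ) = 0 := by
  simp [wnorm]

lemma wnorm_neg (s : ℕ) (f : MvPowerSeries (Fin n) ℂ) : wnorm s (-f) = wnorm s f := by
  simp [wnorm]

lemma wnorm_sum_le {ι : Type*} (t : Finset ι) (s : ℕ) (f : ι → MvPowerSeries (Fin n) ℂ) :
    wnorm s (∑ i ∈ t, f i) ≤ ∑ i ∈ t, wnorm s (f i) := by
  classical
  induction t using Finset.induction_on with
  | empty => simp [wnorm_zero]
  | insert i t hi ih =>
    rw [Finset.sum_insert hi, Finset.sum_insert hi]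
    exact (wnorm_add_le _ _ _).trans (by gcongr)

lemma wnorm_anti {s t : ℕ} (h : s ≤ t) (f : MvPowerSeries (Fin n) ℂ) : wnorm t f ≤ wnorm s f :=
  ENNReal.tsum_le_tsum fun α => by gcongr; exact weight_anti h α

lemma wnorm_monomial (s : ℕ) (α : Fin n →₀ ℕ) (c : ℂ) :
    wnorm s (MvPowerSeries.monomial α c) = ‖c‖ₑ * weight s α := by
  classical
  rw [wnorm, tsum_eq_single α]
  · rw [MvPowerSeries.coeff_monomial_same]
  · intro β hβ
    rw [MvPowerSeries.coeff_monomial_ne hβ]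
    simp

lemma wnorm_mul_le (s : ℕ) (f g : MvPowerSeries (Fin n) ℂ) :
    wnorm s (f * g) ≤ wnorm s f * wnorm s g := by
  classical
  calc wnorm s (f * g)
      ≤ ∑' α : Fin n →₀ ℕ, ∑' x : Finset.HasAntidiagonal.antidiagonal α,
          (‖MvPowerSeries.coeff x.1.1 f‖ₑ * weight s x.1.1) *
            (‖MvPowerSeries.coeff x.1.2 g‖ₑ * weight s x.1.2) := by
        refine ENNReal.tsum_le_tsum fun α => ?_
        rw [tsum_fintype, MvPowerSeries.coeff_mul, Finset.sum_coe_sort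
          (Finset.HasAntidiagonal.antidiagonal α) fun x : (Fin n →₀ ℕ) × (Fin n →₀ ℕ) =>
          (‖MvPowerSeries.coeff x.1 f‖ₑ * weight s x.1) *
            (‖MvPowerSeries.coeff x.2 g‖ₑ * weight s x.2)]
        refine (mul_le_mul_left (enorm_sum_le _ _) _).trans ?_
        rw [Finset.sum_mul]
        refine Finset.sum_le_sum fun x hx => ?_
        rw [← Finset.HasAntidiagonal.mem_antidiagonal.1 hx, weight_add, enorm_mul]
        exact le_of_eq (by ring)
    _ = ∑' x : (Fin n →₀ ℕ) × (Fin n →₀ ℕ), (‖MvPowerSeries.coeff x.1 f‖ₑ * weight s x.1) *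
            (‖MvPowerSeries.coeff x.2 g‖ₑ * weight s x.2) := by
        rw [← Equiv.tsum_eq Finset.HasAntidiagonal.sigmaAntidiagonalEquivProd
          (fun x : (Fin n →₀ ℕ) × (Fin n →₀ ℕ) => (‖MvPowerSeries.coeff x.1 f‖ₑ * weight s x.1) *
            (‖MvPowerSeries.coeff x.2 g‖ₑ * weight s x.2)), ENNReal.tsum_sigma']
        rfl
    _ = wnorm s f * wnorm s g := by
        rw [ENNReal.tsum_prod', wnorm, wnorm, ← ENNReal.tsum_mul_right]
        exact tsum_congr fun α => (by simp only [ENNReal.tsum_mul_left])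

variable (n) in
/-- The ring of convergent power series in `n` variables. -/
def convergentSeries : Subring (MvPowerSeries (Fin n) ℂ) where
  carrier := {f | ∃ s, wnorm s f ≠ ∞}
  mul_mem' := by
    rintro f g ⟨s, hs⟩ ⟨t, ht⟩
    refine ⟨max s t, ne_top_of_le_ne_top (ENNReal.mul_ne_top hs ht) ((wnorm_mul_le _ _ _).trans ?_)⟩
    gcongr
    · exact wnorm_anti (le_max_left _ _) f
    · exact wnorm_anti (le_max_right _ _) g
  one_mem' := ⟨0, by
    rw [← MvPowerSeries.monomial_zero_one, wnorm_monomial]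
    simp [weight]⟩
  add_mem' := by
    rintro f g ⟨s, hs⟩ ⟨t, ht⟩
    refine ⟨max s t, ne_top_of_le_ne_top (ENNReal.add_ne_top.2 ⟨hs, ht⟩)
      ((wnorm_add_le _ _ _).trans ?_)⟩
    gcongr
    · exact wnorm_anti (le_max_left _ _) f
    · exact wnorm_anti (le_max_right _ _) g
  zero_mem' := ⟨0, by simp [wnorm_zero]⟩
  neg_mem' := by
    rintro f ⟨s, hs⟩
    exact ⟨s, by rwa [wnorm_neg]⟩

lemma monomial_mem_convergentSeries (α : Fin n →₀ ℕ) (c : ℂ) :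
    MvPowerSeries.monomial α c ∈ convergentSeries n :=
  ⟨0, by rw [wnorm_monomial]; exact ENNReal.mul_ne_top (by simp) (weight_ne_top _ _)⟩

/-! ### Division with remainder -/

section Division

variable {ι : Type*} (a : ι → Fin n →₀ ℕ) (h : ι → MvPowerSeries (Fin n) ℂ)
  (j : (Fin n →₀ ℕ) → Option ι)

open Classical in
/-- The terms of `u` assigned to the `i`-th divisor, divided by its leading monomial. -/
def quot (i : ι) (u : MvPowerSeries (Fin n) ℂ) : MvPowerSeries (Fin n) ℂ :=
  fun γ => if j (γ + a i) = some i then MvPowerSeries.coeff (γ + a i) u else 0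

lemma coeff_quot (i : ι) (u : MvPowerSeries (Fin n) ℂ) (γ : Fin n →₀ ℕ) [Decidable (j (γ + a i) = some i)] :
    MvPowerSeries.coeff γ (quot a j i u) =
      if j (γ + a i) = some i then MvPowerSeries.coeff (γ + a i) u else 0 := by
  have : MvPowerSeries.coeff γ (quot a j i u) = quot a j i u γ := rfl
  rw [this, quot]
  congr

open Classical in
/-- The terms of `u` not assigned to any divisor. -/
def remainder (u : MvPowerSeries (Fin n) ℂ) : MvPowerSeries (Fin n) ℂ :=
  fun α => if j α = none then MvPowerSeries.coeff α u else 0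

lemma coeff_remainder (u : MvPowerSeries (Fin n) ℂ) (α : Fin n →₀ ℕ) [Decidable (j α = none)] :
    MvPowerSeries.coeff α (remainder j u) =
      if j α = none then MvPowerSeries.coeff α u else 0 := by
  have : MvPowerSeries.coeff α (remainder j u) = remainder j u α := rfl
  rw [this, remainder]
  congr

lemma wnorm_remainder_le (s : ℕ) (u : MvPowerSeries (Fin n) ℂ) :
    wnorm s (remainder j u) ≤ wnorm s u := by
  classical
  refine ENNReal.tsum_le_tsum fun α => ?_
  rw [coeff_remainder]
  split_ifs <;> simp

variable [Fintype ι]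

/-- The correction term in the division. -/
def divisionStep (u : MvPowerSeries (Fin n) ℂ) : MvPowerSeries (Fin n) ℂ :=
  ∑ i, quot a j i u * h i

/-- `j` assigns each exponent to at most one divisor, so the quotients, shifted back by their
leading exponents, are disjoint pieces of `u`. -/
lemma sum_wnorm_quot_le (s : ℕ) (u : MvPowerSeries (Fin n) ℂ) :
    ∑ i, wnorm s (quot a j i u) * weight s (a i) ≤ wnorm s u := by
  classical
  calc ∑ i, wnorm s (quot a j i u) * weight s (a i)
      ≤ ∑ i, ∑' α, (if j α = some i then ‖MvPowerSeries.coeff α u‖ₑ * weight s α else 0) := by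
        refine Finset.sum_le_sum fun i _ => ?_
        rw [wnorm, ← ENNReal.tsum_mul_right]
        refine le_trans (le_of_eq (tsum_congr fun γ => ?_)) (ENNReal.tsum_comp_le_tsum_of_injective
          (add_left_injective (a i)) _)
        rw [coeff_quot, mul_assoc, ← weight_add]
        split_ifs <;> simp
    _ = ∑' α, ∑ i, (if j α = some i then ‖MvPowerSeries.coeff α u‖ₑ * weight s α else 0) :=
        (Summable.tsum_finsetSum fun _ _ => ENNReal.summable).symm
    _ ≤ wnorm s u := by
        refine ENNReal.tsum_le_tsum fun α => ?_
        rcases hα : j α with _ | i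
        · simp
        · simp

lemma wnorm_divisionStep_le (s : ℕ) (hs : ∀ i, wnorm s (h i) ≤ weight s (a i) * 2⁻¹)
    (u : MvPowerSeries (Fin n) ℂ) : wnorm s (divisionStep a h j u) ≤ wnorm s u * 2⁻¹ := by
  refine (wnorm_sum_le _ _ _).trans ?_
  refine le_trans ?_ (mul_le_mul_left (sum_wnorm_quot_le a j s u) _)
  rw [Finset.sum_mul]
  refine Finset.sum_le_sum fun i _ => (wnorm_mul_le _ _ _).trans ?_
  rw [mul_assoc]
  gcongr
  exact hs i

lemma eq_sum_quot_add_remainder (hj : ∀ α i, j α = some i → a i ≤ α)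
    (u : MvPowerSeries (Fin n) ℂ) :
    u = ∑ i, quot a j i u * MvPowerSeries.monomial (a i) 1 + remainder j u := by
  classical
  ext α
  rw [map_add, map_sum, coeff_remainder]
  have : ∀ i, MvPowerSeries.coeff α (quot a j i u * MvPowerSeries.monomial (a i) 1) =
      if j α = some i then MvPowerSeries.coeff α u else 0 := fun i => by
    rw [MvPowerSeries.coeff_mul_monomial, mul_one, coeff_quot]
    by_cases hi : a i ≤ α
    · rw [if_pos hi, tsub_add_cancel_of_le hi]
    · rw [if_neg hi, if_neg fun h' => hi (hj α i h')]
  simp only [this]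
  rcases hα : j α with _ | i <;> simp

/-- Multiplying by `h i` after dividing by the monomial `a i` strictly raises the weight of
exponents, so each coefficient of the step depends only on strictly lighter ones. -/
lemma coeff_divisionStep_congr
    (hh : ∀ i β, MvPowerSeries.coeff β (h i) ≠ 0 → primeWeight (a i) < primeWeight β)
    (u u' : MvPowerSeries (Fin n) ℂ) (α : Fin n →₀ ℕ)
    (huu : ∀ β, primeWeight β < primeWeight α →
      MvPowerSeries.coeff β u = MvPowerSeries.coeff β u') :
    MvPowerSeries.coeff α (divisionStep a h j u) =
      MvPowerSeries.coeff α (divisionStep a h j u') := by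
  classical
  rw [divisionStep, divisionStep, map_sum, map_sum]
  refine Finset.sum_congr rfl fun i _ => ?_
  rw [MvPowerSeries.coeff_mul, MvPowerSeries.coeff_mul]
  refine Finset.sum_congr rfl fun x hx => ?_
  by_cases h0 : MvPowerSeries.coeff x.2 (h i) = 0
  · rw [h0, mul_zero, mul_zero]
  · rw [coeff_quot, coeff_quot, huu]
    rw [← Finset.HasAntidiagonal.mem_antidiagonal.1 hx, primeWeight_add, primeWeight_add]
    exact Nat.mul_lt_mul_of_pos_left (hh i _ h0) (primeWeight_pos _)

/-- Division with remainder of a convergent power series by a finite family of convergent power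
series. -/
theorem exists_division (s : ℕ) (hs : ∀ i, wnorm s (h i) ≤ weight s (a i) * 2⁻¹)
    (hh : ∀ i β, MvPowerSeries.coeff β (h i) ≠ 0 → primeWeight (a i) < primeWeight β)
    (hj : ∀ α i, j α = some i → a i ≤ α) (g : MvPowerSeries (Fin n) ℂ) (hg : wnorm s g ≠ ∞) :
    ∃ (q : ι → MvPowerSeries (Fin n) ℂ) (r : MvPowerSeries (Fin n) ℂ),
      (∀ i, wnorm s (q i) ≠ ∞) ∧ wnorm s r ≠ ∞ ∧
      g = ∑ i, q i * (MvPowerSeries.monomial (a i) 1 - h i) + r ∧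
      ∀ α, MvPowerSeries.coeff α r ≠ 0 → j α = none := by
  classical
  -- Iterates towards the fixed point `u = g + divisionStep a h j u`. Coefficients of weight at most
  -- `m` are final from `G m` on, and the contraction by one half bounds all norms by `2 * wnorm s
  -- g`. Splitting `u` by `j` then gives the quotients and the remainder.
  let G : ℕ → MvPowerSeries (Fin n) ℂ := fun m => Nat.rec 0 (fun _ u => g + divisionStep a h j u) m
  have hG : ∀ m, G (m + 1) = g + divisionStep a h j (G m) := fun _ => rfl
  have hstep : ∀ m α, primeWeight α ≤ m →
      MvPowerSeries.coeff α (G (m + 1)) = MvPowerSeries.coeff α (G m) := by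
    intro m
    induction m with
    | zero => exact fun α hα => absurd hα (primeWeight_pos α).not_ge
    | succ m ih =>
      intro α hα
      rw [hG (m + 1), hG m, map_add, map_add, ← hG m, coeff_divisionStep_congr a h j hh _ _ α fun β hβ => ih β (by lia)]
  have hstab : ∀ α m, primeWeight α ≤ m →
      MvPowerSeries.coeff α (G m) = MvPowerSeries.coeff α (G (primeWeight α)) := by
    intro α m hm
    induction m, hm using Nat.le_induction with
    | base => rfl
    | succ m hm ih => rw [hstep m α hm, ih]
  let u : MvPowerSeries (Fin n) ℂ := fun α => MvPowerSeries.coeff α (G (primeWeight α))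
  have hu : ∀ α m, primeWeight α ≤ m → MvPowerSeries.coeff α (G m) = MvPowerSeries.coeff α u := hstab
  have hfix : u = g + divisionStep a h j u := by
    ext α
    rw [← hu α _ (Nat.le_succ _), hG, map_add, map_add,
      coeff_divisionStep_congr a h j hh _ u α fun β hβ => hu β _ hβ.le]
  have hGn : ∀ m, wnorm s (G m) ≤ 2 * wnorm s g := by
    intro m
    induction m with
    | zero => simp [G, wnorm_zero]
    | succ m ih =>
      rw [hG, two_mul]
      refine (wnorm_add_le _ _ _).trans ?_
      gcongr
      refine (wnorm_divisionStep_le a h j s hs _).trans ((mul_le_mul_left ih _).trans ?_)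
      rw [mul_comm, ← mul_assoc, ENNReal.inv_mul_cancel (by simp) (by simp), one_mul]
  -- On any finite set of exponents `u` agrees with a single iterate, so the uniform bound passes to
  -- `u`.
  have hun : wnorm s u ≠ ∞ := by
    refine ne_top_of_le_ne_top (ENNReal.mul_ne_top (by simp) hg) (b := 2 * wnorm s g) ?_
    rw [wnorm, ENNReal.tsum_eq_iSup_sum]
    refine iSup_le fun F => ?_
    refine le_trans (le_of_eq (Finset.sum_congr rfl fun α hα => ?_))
      ((ENNReal.sum_le_tsum F).trans (hGn (F.sup primeWeight)))
    rw [hu α _ (Finset.le_sup (f := primeWeight) hα)]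
  refine ⟨fun i => quot a j i u, remainder j u, fun i => ?_,
    ne_top_of_le_ne_top hun (wnorm_remainder_le j s u), ?_, fun α hα => ?_⟩
  · have h1 : wnorm s (quot a j i u) * weight s (a i) ≤ wnorm s u :=
      (Finset.single_le_sum (f := fun i => wnorm s (quot a j i u) * weight s (a i))
        (fun _ _ => zero_le) (Finset.mem_univ i)).trans (sum_wnorm_quot_le a j s u)
    intro h2
    rw [h2, ENNReal.top_mul (weight_ne_zero _ _)] at h1
    exact hun (top_le_iff.1 h1)
  · have h1 := eq_sum_quot_add_remainder a j hj u
    simp only [mul_sub, Finset.sum_sub_distrib]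
    rw [sub_add_eq_add_sub, ← h1]
    exact eq_sub_of_add_eq hfix.symm
  · by_contra h0
    rw [coeff_remainder, if_neg h0] at hα
    exact hα rfl

end Division

end ConvergentSeries

/-! ### The ring of convergent power series is noetherian -/

section ConvergentNoetherian

open scoped ENNReal

variable {n : ℕ}

/-- `α` is the exponent of least weight in `f`. -/
def IsLeadingExponent (f : MvPowerSeries (Fin n) ℂ) (α : Fin n →₀ ℕ) : Prop :=
  MvPowerSeries.coeff α f ≠ 0 ∧
    ∀ β, MvPowerSeries.coeff β f ≠ 0 → primeWeight α ≤ primeWeight β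

lemma exists_isLeadingExponent {f : MvPowerSeries (Fin n) ℂ} (hf : f ≠ 0) :
    ∃ α, IsLeadingExponent f α := by
  obtain ⟨α, hα⟩ := (MvPowerSeries.ne_zero_iff_exists_coeff_ne_zero f).1 hf
  obtain ⟨β, hβ, hm⟩ := WellFounded.has_min (measure (primeWeight (n := n))).wf
    {α | MvPowerSeries.coeff α f ≠ 0} ⟨α, hα⟩
  exact ⟨β, hβ, fun γ hγ => not_lt.1 (hm γ hγ)⟩

/-- Dickson's lemma. -/
lemma exists_finite_dominating (E : Set (Fin n →₀ ℕ)) :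
    ∃ S : Set (Fin n →₀ ℕ), S.Finite ∧ S ⊆ E ∧ ∀ α ∈ E, ∃ β ∈ S, β ≤ α := by
  refine ⟨{α | Minimal (· ∈ E) α}, ?_, fun α hα => hα.1, fun α hα => ?_⟩
  · exact WellQuasiOrderedLE.finite_of_isAntichain (setOfPred_minimal_antichain _)
  · obtain ⟨β, hβ, hm⟩ := exists_minimal_le_of_wellFoundedLT (· ∈ E) α hα
    exact ⟨β, hm, hβ⟩

lemma wnorm_add_param_le (f : MvPowerSeries (Fin n) ℂ) (N s t : ℕ)
    (h : ∀ β, MvPowerSeries.coeff β f ≠ 0 → N ≤ primeWeight β) :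
    wnorm (s + t) f ≤ ((N : ℝ≥0∞)⁻¹) ^ t * wnorm s f := by
  rw [wnorm, wnorm, ← ENNReal.tsum_mul_left]
  refine ENNReal.tsum_le_tsum fun β => ?_
  by_cases hβ : MvPowerSeries.coeff β f = 0
  · simp [hβ]
  · rw [weight, pow_add, mul_comm (_ ^ s), ← mul_assoc, mul_comm ‖_‖ₑ, mul_assoc, weight]
    gcongr
    exact h β hβ

/-- The weighted norm of a series with exponents of weight greater than `N` is small compared to
`N ^ (-s)` for large `s`. -/
lemma exists_wnorm_le (f : MvPowerSeries (Fin n) ℂ) (s : ℕ) (hs : wnorm s f ≠ ∞) (α : Fin n →₀ ℕ)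
    (h : ∀ β, MvPowerSeries.coeff β f ≠ 0 → primeWeight α < primeWeight β) :
    ∃ t₀, ∀ t, t₀ ≤ t → wnorm t f ≤ weight t α * 2⁻¹ := by
  set N := primeWeight α
  have hN : (N : ℝ≥0∞) ≠ 0 := by exact_mod_cast (primeWeight_pos α).ne'
  -- The exponents of `f` have integer weight at least `N + 1`, so raising the parameter by `k`
  -- shrinks the norm, relative to the weight of `α`, by the factor `(N / (N + 1)) ^ k`.
  have hlt : (N : ℝ≥0∞) * ((N + 1 : ℕ) : ℝ≥0∞)⁻¹ < 1 := by
    rw [← div_eq_mul_inv]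
    refine ENNReal.div_lt_of_lt_mul ?_
    rw [one_mul]
    exact_mod_cast Nat.lt_succ_self N
  have hlim := ENNReal.Tendsto.mul_const (b := wnorm s f * (N : ℝ≥0∞) ^ s * 2)
    (ENNReal.tendsto_pow_atTop_nhds_zero_of_lt_one hlt)
    (Or.inr (ENNReal.mul_ne_top (ENNReal.mul_ne_top hs (by simp)) (by simp)))
  rw [zero_mul] at hlim
  obtain ⟨t₀, ht₀⟩ := Filter.eventually_atTop.1 (hlim.eventually_le_const zero_lt_one)
  refine ⟨s + t₀, fun t ht => ?_⟩
  obtain ⟨k, rfl⟩ := Nat.exists_eq_add_of_le ((Nat.le_add_right s t₀).trans ht)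
  refine (wnorm_add_param_le f (N + 1) s k h).trans ?_
  have h1 := ht₀ k (by lia)
  rw [weight]
  change _ ≤ (N : ℝ≥0∞)⁻¹ ^ (s + k) * 2⁻¹
  rw [show (N : ℝ≥0∞)⁻¹ ^ (s + k) * 2⁻¹ = ((N : ℝ≥0∞) ^ (s + k) * 2)⁻¹ by
    rw [← ENNReal.inv_pow, ENNReal.mul_inv (by simp) (by simp)], ENNReal.le_inv_iff_mul_le]
  refine le_trans (le_of_eq ?_) h1
  rw [mul_pow, pow_add]
  ring

/-- A standard basis argument: choose elements of `I` whose leading exponents dominate, by Dickson's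
lemma, those of all of `I`. The remainder of an element of `I` on division by them lies in `I` and
has no exponent above a chosen one, hence is zero. -/
theorem isNoetherianRing_convergentSeries : IsNoetherianRing (convergentSeries n) := by
  classical
  rw [isNoetherianRing_iff_ideal_fg]
  intro I
  let E : Set (Fin n →₀ ℕ) := {α | ∃ f ∈ I, IsLeadingExponent f.1 α}
  obtain ⟨S, hSf, hSE, hS⟩ := exists_finite_dominating E
  have := hSf.fintype
  have hnorm : ∀ a : S, ∃ f ∈ I, MvPowerSeries.coeff a.1 f.1 = 1 ∧ IsLeadingExponent f.1 a.1 := by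
    rintro ⟨α, hα⟩
    obtain ⟨f, hf, hl⟩ := hSE hα
    let c : convergentSeries n := ⟨MvPowerSeries.monomial 0 (MvPowerSeries.coeff α f.1)⁻¹,
      monomial_mem_convergentSeries _ _⟩
    have hc : ∀ β, MvPowerSeries.coeff β (c * f).1 =
        (MvPowerSeries.coeff α f.1)⁻¹ * MvPowerSeries.coeff β f.1 := fun β =>
      MvPowerSeries.coeff_C_mul ..
    refine ⟨c * f, I.mul_mem_left c hf, ?_, ?_, fun β hβ => ?_⟩
    · rw [hc, inv_mul_cancel₀ hl.1]
    · rw [hc, inv_mul_cancel₀ hl.1]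
      exact one_ne_zero
    · rw [hc] at hβ
      exact hl.2 β (right_ne_zero_of_mul hβ)
  choose f hfI hf1 hfl using hnorm
  let h : S → MvPowerSeries (Fin n) ℂ := fun a => MvPowerSeries.monomial a.1 1 - (f a).1
  have hh : ∀ a β, MvPowerSeries.coeff β (h a) ≠ 0 → primeWeight a.1 < primeWeight β := by
    intro a β hβ
    by_cases hab : β = a.1
    · subst hab
      simp [h, hf1] at hβ
    · rw [map_sub, MvPowerSeries.coeff_monomial_ne hab, zero_sub, neg_ne_zero] at hβ
      exact lt_of_le_of_ne ((hfl a).2 β hβ) fun e => hab (primeWeight_injective e).symm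
  have hb : ∀ a, ∃ t₀, ∀ t, t₀ ≤ t → wnorm t (h a) ≤ weight t a.1 * 2⁻¹ := fun a => by
    obtain ⟨s, hs⟩ := sub_mem (monomial_mem_convergentSeries a.1 1) (f a).2
    exact exists_wnorm_le (h a) s hs a.1 (hh a)
  choose t ht using hb
  let j : (Fin n →₀ ℕ) → Option S := fun α => if hα : ∃ a : S, a.1 ≤ α then some hα.choose else none
  have hj : ∀ α a, j α = some a → a.1 ≤ α := fun α a hα => by
    by_cases he : ∃ a : S, a.1 ≤ α
    · simp only [j, dif_pos he, Option.some.injEq] at hα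
      exact hα ▸ he.choose_spec
    · simp only [j] at hα
      rw [dif_neg he] at hα
      cases hα
  refine ⟨Finset.univ.image f, le_antisymm (Ideal.span_le.2 ?_) fun g hg => ?_⟩
  · intro x hx
    obtain ⟨a, -, rfl⟩ := Finset.mem_image.1 (Finset.mem_coe.1 hx)
    exact hfI a
  · obtain ⟨s, hs⟩ := g.2
    -- One parameter large enough for `g` to have finite norm and for every divisor to be dominated
    -- by its leading term.
    obtain ⟨q, r, hq, hr, hgr, hrj⟩ := exists_division (fun a : S => a.1) h j
      (max s (Finset.univ.sup t))
      (fun a => ht a _ ((Finset.le_sup (Finset.mem_univ a)).trans (le_max_right _ _))) hh hj g.1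
      (ne_top_of_le_ne_top hs (wnorm_anti (le_max_left _ _) _))
    let q' : S → convergentSeries n := fun a => ⟨q a, _, hq a⟩
    have hsum : (∑ a, q' a * f a) ∈ Ideal.span ((Finset.univ.image f : Finset _) : Set _) :=
      Ideal.sum_mem _ fun a _ => Ideal.mul_mem_left _ _ (Ideal.subset_span (by simp))
    have hsum' : (∑ a, q' a * f a) ∈ I := Ideal.sum_mem _ fun a _ => I.mul_mem_left _ (hfI a)
    have hgr' : g.1 - (∑ a, q' a * f a).1 = r := by
      rw [sub_eq_iff_eq_add', hgr]
      simp [h, q']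
    have hr0 : r = 0 := by
      by_contra hne
      obtain ⟨α, hα⟩ := exists_isLeadingExponent hne
      have hαE : α ∈ E := ⟨g - ∑ a, q' a * f a, I.sub_mem hg hsum', by
        rw [← hgr'] at hα
        exact hα⟩
      obtain ⟨β, hβ, hle⟩ := hS α hαE
      have h1 := hrj α hα.1
      simp only [j] at h1
      rw [dif_pos ⟨⟨β, hβ⟩, hle⟩] at h1
      exact Option.some_ne_none _ h1
    rw [hr0, sub_eq_zero] at hgr'
    rwa [Subtype.ext hgr']

end ConvergentNoetherian

/-! ### Cauchy estimates and Taylor expansion in several variables -/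

section TaylorSeries

open Metric Set
open scoped ContDiff Nat

variable {E : Type*} [NormedAddCommGroup E] [NormedSpace ℂ E] {f : E → ℂ} {q : E} {R : ℝ}

/-- Each derivative costs `δ` of the radius and, by Cauchy's estimate on a ball of radius `δ`, a
factor `2 / δ`; the 2 bounds the difference of two values. -/
lemma norm_iteratedFDeriv_le_of_ball (hf : ContDiffOn ℂ ∞ f (ball q R)) {M δ : ℝ} (hδ : 0 < δ)
    (hM : ∀ x ∈ ball q R, ‖f x‖ ≤ M) (j : ℕ) :
    ∀ x ∈ ball q (R - j * δ), ‖iteratedFDeriv ℂ j f x‖ ≤ M * (2 / δ) ^ j := by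
  induction j with
  | zero =>
    intro x hx
    simpa using hM x (by simpa using hx)
  | succ j ih =>
    intro x hx
    have hsub : ball x δ ⊆ ball q (R - j * δ) := by
      refine ball_subset_ball' ?_
      rw [mem_ball] at hx
      push_cast at hx
      linarith
    have hsub' : ball x δ ⊆ ball q R :=
      hsub.trans (ball_subset_ball (sub_le_self _ (by positivity)))
    rw [← norm_fderiv_iteratedFDeriv]
    refine (Complex.norm_fderiv_le_div_of_mapsTo_ball (R₂ := 2 * (M * (2 / δ) ^ j))
      (fun y hy => ?_) (fun y hy => ?_) hδ).trans (le_of_eq ?_)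
    · exact (((hf.contDiffAt (isOpen_ball.mem_nhds (hsub' hy))).differentiableAt_iteratedFDeriv
        (by exact_mod_cast WithTop.coe_lt_top _))).differentiableWithinAt
    · rw [mem_closedBall, dist_eq_norm]
      refine (norm_sub_le _ _).trans ?_
      have h1 := ih y (hsub hy)
      have h2 := ih x (hsub (mem_ball_self hδ))
      linarith
    · rw [pow_succ]
      field_simp

lemma exists_norm_iteratedFDeriv_le (hf : ContDiffOn ℂ ∞ f (ball q R)) (hR : 0 < R) {M : ℝ}
    (hM : ∀ x ∈ ball q R, ‖f x‖ ≤ M) :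
    ∃ A C : ℝ, 0 ≤ A ∧ 0 < C ∧ ∀ k, ‖iteratedFDeriv ℂ k f q‖ ≤ k ! * (A * C ^ k) := by
  have hM0 : 0 ≤ M := (norm_nonneg _).trans (hM q (mem_ball_self hR))
  refine ⟨M * Real.exp 1, 2 / R * Real.exp 1, by positivity, by positivity, fun k => ?_⟩
  -- With this `δ`, `k` steps stay inside the ball, and `(k + 1) ^ k ≤ k! * exp (k + 1)` turns the
  -- bound into geometric growth times `k!`.
  have hδ : 0 < R / (k + 1) := by positivity
  refine (norm_iteratedFDeriv_le_of_ball hf hδ hM k q (mem_ball_self ?_)).trans ?_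
  · rw [mul_div_assoc', sub_pos, div_lt_iff₀ (by positivity)]
    nlinarith
  · have h := Real.pow_div_factorial_le_exp (x := (k : ℝ) + 1) (by positivity) k
    rw [div_le_iff₀ (by positivity)] at h
    calc M * (2 / (R / (k + 1))) ^ k = M * (2 / R) ^ k * ((k : ℝ) + 1) ^ k := by
          rw [mul_assoc, ← mul_pow]
          congr 2
          field_simp
      _ ≤ M * (2 / R) ^ k * (Real.exp (k + 1) * k !) := by gcongr
      _ = _ := by
          rw [Real.exp_add, mul_pow, ← Real.exp_nat_mul, mul_one]
          ring

/-- Restrict `f` to the complex line `t ↦ q + t z` and evaluate its one-variable Taylor series at `t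
= 1`. -/
lemma hasSum_iteratedFDeriv_of_ball (hf : ContDiffOn ℂ ∞ f (ball q R)) {z : E} (hz : ‖z‖ < R) :
    HasSum (fun k : ℕ => (k ! : ℂ)⁻¹ * iteratedFDeriv ℂ k f q fun _ => z) (f (q + z)) := by
  let L : ℂ →L[ℂ] E := ContinuousLinearMap.toSpanSingleton ℂ z
  let g : E → ℂ := fun y => f (q + y)
  have hg : ContDiffOn ℂ ∞ g (ball 0 R) := hf.comp (contDiff_const.add contDiff_id).contDiffOn
    fun y hy => by simpa using hy
  have hs : IsOpen (L ⁻¹' ball 0 R) := isOpen_ball.preimage L.continuous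
  have hR : 0 < R := (norm_nonneg z).trans_lt hz
  -- This radius exceeds 1 because `‖z‖ < R`, yet the line stays in the ball even when `z = 0`.
  have hL : ball (0 : ℂ) (2 * R / (R + ‖z‖)) ⊆ L ⁻¹' ball 0 R := by
    intro t ht
    have h0 : 0 < R + ‖z‖ := by positivity
    rw [mem_ball_zero_iff, lt_div_iff₀ h0] at ht
    rw [mem_preimage, mem_ball_zero_iff, ContinuousLinearMap.toSpanSingleton_apply, norm_smul]
    rcases (norm_nonneg z).eq_or_lt with h | h
    · rw [← h]
      simpa using hR
    · nlinarith [norm_nonneg t]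
  have hgL : ContDiffOn ℂ ∞ (g ∘ L) (L ⁻¹' ball 0 R) := hg.comp L.contDiff.contDiffOn fun _ h => h
  have h1 : (1 : ℂ) ∈ ball (0 : ℂ) (2 * R / (R + ‖z‖)) := by
    rw [mem_ball_zero_iff, norm_one, lt_div_iff₀ (by positivity)]
    linarith
  have h := Complex.hasSum_taylorSeries_on_ball
    ((hgL.differentiableOn (by simp)).mono hL) h1
  have h0 : L 0 ∈ ball (0 : E) R := by simpa using hR
  have h2 : (g ∘ L) 1 = f (q + z) := by simp [g, L]
  rw [h2] at h
  convert! h using 2 with k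
  rw [sub_zero, one_pow, one_smul, smul_eq_mul, iteratedDeriv_eq_iteratedFDeriv,
    ← iteratedFDerivWithin_of_isOpen k hs (by exact h0),
    L.iteratedFDerivWithin_comp_right hg isOpen_ball.uniqueDiffOn hs.uniqueDiffOn h0
      (by exact_mod_cast le_top), iteratedFDerivWithin_of_isOpen k isOpen_ball h0]
  simp [g, L, iteratedFDeriv_comp_add_left]

end TaylorSeries

/-! ### Evaluating convergent power series -/

section Evaluation

open scoped ENNReal Topology

variable {n : ℕ}

/-- The monomial function `z ↦ z ^ α`. -/
def monom (z : Fin n → ℂ) (α : Fin n →₀ ℕ) : ℂ := α.prod fun i k => z i ^ k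

lemma monom_zero (z : Fin n → ℂ) : monom z 0 = 1 := Finsupp.prod_zero_index

lemma monom_add (z : Fin n → ℂ) (α β : Fin n →₀ ℕ) :
    monom z (α + β) = monom z α * monom z β :=
  Finsupp.prod_add_index' (fun _ => pow_zero _) fun _ _ _ => pow_add _ _ _

lemma monom_single (z : Fin n → ℂ) (i : Fin n) : monom z (Finsupp.single i 1) = z i := by
  simp [monom]

/-- A polydisc on which the monomials are bounded by their weights. -/
def polydisc (s : ℕ) : Set (Fin n → ℂ) := {z | ∀ i, ‖z i‖ₑ ≤ weight s (Finsupp.single i 1)}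

lemma weight_zero (s : ℕ) : weight s (0 : Fin n →₀ ℕ) = 1 := by
  simp [weight, primeWeight_eq]

/-- Both sides are multiplicative in the exponent, so the case of a single variable suffices, and
that is the definition of `polydisc`. -/
lemma enorm_monom_le {s : ℕ} {z : Fin n → ℂ} (hz : z ∈ polydisc s) (α : Fin n →₀ ℕ) :
    ‖monom z α‖ₑ ≤ weight s α := by
  induction α using Finsupp.induction_linear with
  | zero => simp [monom_zero, weight_zero]
  | add α β hα hβ =>
    rw [monom_add, weight_add, enorm_mul]
    gcongr
  | single i k =>
    induction k with
    | zero => simp [monom_zero, weight_zero]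
    | succ k ih =>
      rw [Finsupp.single_add, monom_add, weight_add, enorm_mul, monom_single]
      gcongr
      exact hz i

lemma polydisc_mem_nhds (s : ℕ) : polydisc s ∈ 𝓝 (0 : Fin n → ℂ) := by
  refine Filter.eventually_all.2 fun i => ?_
  have h : Filter.Tendsto (fun z : Fin n → ℂ => ‖z i‖ₑ) (𝓝 0) (𝓝 0) := by
    have : Continuous fun z : Fin n → ℂ => ‖z i‖ₑ := by fun_prop
    simpa using this.tendsto 0
  exact h.eventually_le_const (pos_iff_ne_zero.2 (weight_ne_zero s _))

/-- The function defined by a power series near the origin. -/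
def evalFun (a : MvPowerSeries (Fin n) ℂ) (z : Fin n → ℂ) : ℂ :=
  ∑' α, MvPowerSeries.coeff α a * monom z α

lemma summable_norm_eval {s : ℕ} {a : MvPowerSeries (Fin n) ℂ} (ha : wnorm s a ≠ ∞)
    {z : Fin n → ℂ} (hz : z ∈ polydisc s) :
    Summable fun α => ‖MvPowerSeries.coeff α a * monom z α‖ := by
  rw [← tsum_enorm_ne_top_iff_summable_norm]
  refine ne_top_of_le_ne_top ha (ENNReal.tsum_le_tsum fun α => ?_)
  rw [enorm_mul]
  gcongr
  exact enorm_monom_le hz α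

lemma evalFun_zero (z : Fin n → ℂ) : evalFun 0 z = 0 := by simp [evalFun]

lemma evalFun_one (z : Fin n → ℂ) : evalFun 1 z = 1 := by
  classical
  rw [evalFun, tsum_eq_single 0]
  · simp [monom_zero]
  · intro α hα
    rw [MvPowerSeries.coeff_one, if_neg hα, zero_mul]

lemma evalFun_add {s : ℕ} {a b : MvPowerSeries (Fin n) ℂ} (ha : wnorm s a ≠ ∞)
    (hb : wnorm s b ≠ ∞) {z : Fin n → ℂ} (hz : z ∈ polydisc s) :
    evalFun (a + b) z = evalFun a z + evalFun b z := by
  rw [evalFun, evalFun, evalFun, ← (summable_norm_eval ha hz).of_norm.tsum_add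
    (summable_norm_eval hb hz).of_norm]
  exact tsum_congr fun α => by rw [map_add, add_mul]

lemma evalFun_mul {s : ℕ} {a b : MvPowerSeries (Fin n) ℂ} (ha : wnorm s a ≠ ∞)
    (hb : wnorm s b ≠ ∞) {z : Fin n → ℂ} (hz : z ∈ polydisc s) :
    evalFun (a * b) z = evalFun a z * evalFun b z := by
  classical
  have h := summable_mul_of_summable_norm
    (f := fun α => MvPowerSeries.coeff α a * monom z α)
    (g := fun α => MvPowerSeries.coeff α b * monom z α)
    (summable_norm_eval ha hz) (summable_norm_eval hb hz)
  rw [evalFun, evalFun, evalFun, Summable.tsum_mul_tsum_eq_tsum_sum_antidiagonal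
    (summable_norm_eval ha hz).of_norm (summable_norm_eval hb hz).of_norm h]
  refine tsum_congr fun α => ?_
  rw [MvPowerSeries.coeff_mul, Finset.sum_mul]
  refine Finset.sum_congr rfl fun x hx => ?_
  rw [← Finset.HasAntidiagonal.mem_antidiagonal.1 hx, monom_add]
  ring

/-- The exponent of the monomial `∏ j, z (w j)`. -/
def content {k : ℕ} (w : Fin k → Fin n) : Fin n →₀ ℕ := ∑ j, Finsupp.single (w j) 1

lemma monom_content (z : Fin n → ℂ) {k : ℕ} (w : Fin k → Fin n) :
    monom z (content w) = ∏ j, z (w j) := by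
  induction k with
  | zero => simp [content, monom_zero]
  | succ k ih =>
    have h : content w = Finsupp.single (w 0) 1 + content (fun j : Fin k => w j.succ) := by
      rw [content, Fin.sum_univ_succ]
      rfl
    rw [h, monom_add, monom_single, ih, Fin.prod_univ_succ]

lemma weight_content (s : ℕ) {k : ℕ} (w : Fin k → Fin n) :
    weight s (content w) = ∏ j, weight s (Finsupp.single (w j) 1) := by
  induction k with
  | zero => simp [content, weight_zero]
  | succ k ih =>
    have h : content w = Finsupp.single (w 0) 1 + content (fun j : Fin k => w j.succ) := by
      rw [content, Fin.sum_univ_succ]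
      rfl
    rw [h, weight_add, ih, Fin.prod_univ_succ]

lemma exists_content_eq (α : Fin n →₀ ℕ) : ∃ w : Fin α.degree → Fin n, content w = α := by
  suffices ∀ k, ∀ α : Fin n →₀ ℕ, α.degree = k → ∃ w : Fin k → Fin n, content w = α from
    this _ α rfl
  intro k
  induction k with
  | zero => exact fun α hα => ⟨Fin.elim0, by
      simpa [content] using ((Finsupp.degree_eq_zero_iff α).1 hα).symm⟩
  | succ k ih =>
    intro α hα
    obtain ⟨i, hi⟩ : ∃ i, α i ≠ 0 := by
      by_contra! h
      rw [show α = 0 from Finsupp.ext h, map_zero] at hα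
      omega
    have hle : Finsupp.single i 1 ≤ α := by simpa [Nat.one_le_iff_ne_zero] using hi
    obtain ⟨w, hw⟩ := ih (α - Finsupp.single i 1) (by
      have := congrArg Finsupp.degree (tsub_add_cancel_of_le hle)
      rw [map_add, Finsupp.degree_single] at this
      omega)
    refine ⟨Fin.cons i w, ?_⟩
    rw [content, Fin.sum_univ_succ]
    simp only [Fin.cons_zero, Fin.cons_succ]
    rw [← content, hw, add_tsub_cancel_of_le hle]

end Evaluation

/-! ### Holomorphic functions and convergent power series -/

section Expansion

open Metric
open scoped ENNReal Topology ContDiff Nat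

variable {n : ℕ}

lemma weight_single_le (s : ℕ) (i : Fin n) :
    weight s (Finsupp.single i 1) ≤ ((2 : ℝ≥0∞)⁻¹) ^ s := by
  refine pow_le_pow_left₀ zero_le (ENNReal.inv_le_inv.2 ?_) s
  rw [primeWeight_eq]
  simpa using! (Nat.prime_nth_prime i).two_le

/-- There are `n ^ k` words of length `k`, each of weight at most `2 ^ (-s k)`; once `n C 2 ^ (-s) ≤
1/2` a geometric series dominates. -/
lemma exists_tsum_words_ne_top (c : (Σ k, Fin k → Fin n) → ℂ) {A C : ℝ}
    (hc : ∀ x, ‖c x‖ ≤ A * C ^ x.1) (hA : 0 ≤ A) (hC : 0 ≤ C) :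
    ∃ s, ∑' x, ‖c x‖ₑ * weight s (content x.2) ≠ ⊤ := by
  have ht : Filter.Tendsto (fun s : ℕ => n * ENNReal.ofReal C * ((2 : ℝ≥0∞)⁻¹) ^ s) Filter.atTop
      (𝓝 0) := by
    rw [← mul_zero (n * ENNReal.ofReal C)]
    exact ENNReal.Tendsto.const_mul
      (ENNReal.tendsto_pow_atTop_nhds_zero_of_lt_one (by simp))
      (Or.inr (ENNReal.mul_ne_top (by simp) ENNReal.ofReal_ne_top))
  obtain ⟨s, hs⟩ := (ht.eventually_le_const (u := 2⁻¹) (by simp)).exists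
  refine ⟨s, ne_top_of_le_ne_top (b := ENNReal.ofReal A * ∑' k, ((2 : ℝ≥0∞)⁻¹) ^ k) ?_ ?_⟩
  · rw [ENNReal.tsum_geometric]
    exact ENNReal.mul_ne_top ENNReal.ofReal_ne_top (by simp)
  · rw [ENNReal.tsum_sigma', ← ENNReal.tsum_mul_left]
    refine ENNReal.tsum_le_tsum fun k => ?_
    rw [tsum_fintype]
    calc ∑ w : Fin k → Fin n, ‖c ⟨k, w⟩‖ₑ * weight s (content w)
        ≤ ∑ _w : Fin k → Fin n, ENNReal.ofReal A * ENNReal.ofReal C ^ k *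
            (((2 : ℝ≥0∞)⁻¹) ^ s) ^ k := by
          refine Finset.sum_le_sum fun w _ => ?_
          gcongr
          · rw [← ENNReal.ofReal_pow hC, ← ENNReal.ofReal_mul hA, ← ofReal_norm]
            exact ENNReal.ofReal_le_ofReal (hc ⟨k, w⟩)
          · rw [weight_content]
            refine (Finset.prod_le_prod' fun j _ => weight_single_le s (w j)).trans ?_
            simp
      _ = ENNReal.ofReal A * (n * ENNReal.ofReal C * ((2 : ℝ≥0∞)⁻¹) ^ s) ^ k := by
          rw [Finset.sum_const, Finset.card_univ, Fintype.card_fun, Fintype.card_fin,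
            Fintype.card_fin, nsmul_eq_mul, mul_pow, mul_pow]
          push_cast
          ring
      _ ≤ _ := by gcongr

lemma map_diag_eq_sum {k : ℕ} (p : ContinuousMultilinearMap ℂ (fun _ : Fin k => Fin n → ℂ) ℂ)
    (z : Fin n → ℂ) :
    p (fun _ => z) = ∑ w : Fin k → Fin n, p (fun j => Pi.single (w j) 1) * monom z (content w) := by
  have hz : z = ∑ i, z i • (Pi.single i 1 : Fin n → ℂ) := pi_eq_sum_univ' z
  conv_lhs => rw [hz]
  rw [p.map_sum]
  refine Finset.sum_congr rfl fun w _ => ?_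
  rw [p.map_smul_univ, monom_content, smul_eq_mul, mul_comm]

/-- A holomorphic function is given by a convergent power series near each point. -/
lemma exists_evalFun_eq {f : (Fin n → ℂ) → ℂ} {q : Fin n → ℂ} {R M : ℝ} (hR : 0 < R)
    (hf : ContDiffOn ℂ ∞ f (ball q R)) (hM : ∀ x ∈ ball q R, ‖f x‖ ≤ M) :
    ∃ a ∈ convergentSeries n, ∀ᶠ z in 𝓝 0, f (q + z) = evalFun a z := by
  obtain ⟨A, C, hA, hC, hAC⟩ := exists_norm_iteratedFDeriv_le hf hR hM
  let c : (Σ k, Fin k → Fin n) → ℂ := fun x =>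
    (x.1 ! : ℂ)⁻¹ * iteratedFDeriv ℂ x.1 f q fun j => Pi.single (x.2 j) 1
  obtain ⟨s, hs⟩ := exists_tsum_words_ne_top c (A := A) (C := C) (fun x => by
    rw [norm_mul, norm_inv, Complex.norm_natCast, inv_mul_le_iff₀ (by positivity)]
    refine ((iteratedFDeriv ℂ x.1 f q).le_opNorm _).trans ?_
    simpa [Pi.norm_single] using hAC x.1) hA hC.le
  let g : (Σ k, Fin k → Fin n) → (Fin n →₀ ℕ) := fun x => content x.2
  -- Coefficients are collected from all words with the same content, which avoids multinomial
  -- coefficients.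
  let a : MvPowerSeries (Fin n) ℂ := fun α => ∑' x : g ⁻¹' {α}, c x
  have ha : ∀ α, MvPowerSeries.coeff α a = ∑' x : g ⁻¹' {α}, c x := fun α => rfl
  refine ⟨a, ⟨s, ne_top_of_le_ne_top hs ?_⟩, ?_⟩
  · rw [← ENNReal.tsum_fiberwise _ g]
    refine ENNReal.tsum_le_tsum fun α => ?_
    rw [ha]
    refine (mul_le_mul_left enorm_tsum_le_tsum_enorm _).trans (le_of_eq ?_)
    rw [← ENNReal.tsum_mul_right]
    exact tsum_congr fun x => congrArg (fun β => ‖c x‖ₑ * weight s β) (Eq.symm x.2)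
  · filter_upwards [polydisc_mem_nhds s, ball_mem_nhds 0 hR] with z hz hzR
    have hsum : Summable fun x => c x * monom z (g x) := by
      refine Summable.of_enorm (ne_top_of_le_ne_top hs (ENNReal.tsum_le_tsum fun x => ?_))
      rw [enorm_mul]
      gcongr
      exact enorm_monom_le hz _
    have h1 := hsum.hasSum.sigma fun k => hasSum_fintype _
    have h2 := hasSum_iteratedFDeriv_of_ball hf (mem_ball_zero_iff.1 hzR)
    have h3 : f (q + z) = ∑' x, c x * monom z (g x) := by
      refine h2.unique ?_
      convert! h1 using 2 with k
      rw [map_diag_eq_sum, Finset.mul_sum]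
      exact Finset.sum_congr rfl fun w _ => (mul_assoc _ _ _).symm
    rw [h3, evalFun, ← (hsum.hasSum.tsum_fiberwise g).tsum_eq]
    refine tsum_congr fun α => ?_
    rw [ha, ← tsum_mul_right]
    exact tsum_congr fun x => congrArg (fun β => c x * monom z β) x.2

/-- A convergent power series defines a holomorphic function near the origin. -/
lemma analyticAt_evalFun {a : MvPowerSeries (Fin n) ℂ} (ha : a ∈ convergentSeries n) :
    AnalyticAt ℂ (evalFun a) 0 := by
  obtain ⟨s, hs⟩ := ha
  obtain ⟨r, hr, hrs⟩ := Metric.nhds_basis_closedBall.mem_iff.1 (polydisc_mem_nhds (n := n) s)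
  lift r to NNReal using hr.le
  let I : ℕ → Type := fun k => {α : Fin n →₀ ℕ // α.degree = k}
  have hI : ∀ k, Fintype (I k) := fun k => (Finsupp.finite_of_degree_eq k).fintype
  have hw : ∀ k (α : I k), ∃ w : Fin k → Fin n, content w = α.1 := by
    rintro k ⟨α, rfl⟩
    exact exists_content_eq α
  choose w hw using hw
  -- A multilinear form of norm at most 1 whose diagonal is the monomial `α`; any ordering `w k α`
  -- of its variables will do, symmetry is not required.
  let m : ∀ k, I k → ContinuousMultilinearMap ℂ (fun _ : Fin k => Fin n → ℂ) ℂ := fun k α =>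
    (ContinuousMultilinearMap.mkPiAlgebra ℂ (Fin k) ℂ).compContinuousLinearMap
      fun j => ContinuousLinearMap.proj (w k α j)
  have hm : ∀ k α, ‖m k α‖ ≤ 1 := fun k α => by
    refine ContinuousMultilinearMap.opNorm_le_bound zero_le_one fun z => ?_
    rw [one_mul]
    simp only [m, ContinuousMultilinearMap.compContinuousLinearMap_apply,
      ContinuousMultilinearMap.mkPiAlgebra_apply, norm_prod]
    exact Finset.prod_le_prod (fun _ _ => norm_nonneg _) fun j _ => norm_le_pi_norm (z j) _
  have hmz : ∀ k α z, m k α (fun _ => z) = monom z α.1 := fun k α z => by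
    rw [← hw k α, monom_content]
    simp [m]
  let p : FormalMultilinearSeries ℂ (Fin n → ℂ) ℂ := fun k =>
    ∑ α : I k, MvPowerSeries.coeff α.1 a • m k α
  have hsum := summable_norm_eval hs (hrs (show (fun _ : Fin n => (r : ℂ)) ∈ closedBall 0 (r : ℝ) from
    mem_closedBall_zero_iff.2 ((pi_norm_le_iff_of_nonneg r.2).2 fun _ => by simp)))
  refine HasFPowerSeriesAt.analyticAt (p := p) ⟨r, ?_, by exact_mod_cast hr, fun {y} hy => ?_⟩
  · refine p.le_radius_of_bound
      (∑' α, ‖MvPowerSeries.coeff α a * monom (fun _ => (r : ℂ)) α‖) fun k => ?_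
    calc ‖p k‖ * r ^ k ≤ (∑ α : I k, ‖MvPowerSeries.coeff α.1 a‖) * r ^ k := by
          gcongr
          refine norm_sum_le_of_le _ fun α _ => ?_
          rw [norm_smul]
          exact mul_le_of_le_one_right (norm_nonneg _) (hm k α)
      _ = ∑ α : I k, ‖MvPowerSeries.coeff α.1 a * monom (fun _ => (r : ℂ)) α.1‖ := by
          rw [Finset.sum_mul]
          refine Finset.sum_congr rfl fun α _ => ?_
          rw [norm_mul, ← hw k α, monom_content]
          simp
      _ ≤ ∑' α, ‖MvPowerSeries.coeff α a * monom (fun _ => (r : ℂ)) α‖ := by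
          rw [← tsum_fintype (L := .unconditional _)]
          exact hsum.tsum_subtype_le _ {α | α.degree = k} fun _ => norm_nonneg _
  · rw [zero_add]
    rw [eball_coe] at hy
    have h := (summable_norm_eval hs (hrs (ball_subset_closedBall hy))).of_norm.hasSum
    convert! ((Equiv.sigmaFiberEquiv Finsupp.degree).hasSum_iff.2 h).sigma
      fun k => hasSum_fintype (β := I k) _ using 2 with k
    simp only [p, sum_apply, smul_apply, hmz]
    rfl

end Expansion

/-! ### Stalks of the sheaf of holomorphic functions -/

section HolomorphicStalk

open scoped ContDiff Topology Manifold

variable {n : ℕ}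

variable (n) in
/-- The space `ℂⁿ` with its sheaf of holomorphic functions. -/
abbrev affineSpace : LocallyRingedSpace.{0} :=
  ChartedSpace.locallyRingedSpace (modelWithCornersSelf ℂ (Fin n → ℂ)) (Fin n → ℂ)

/-- An analytic function on an open set, as a section of the sheaf of holomorphic functions. -/
def analyticSection (F : (Fin n → ℂ) → ℂ) (U : Opens (Fin n → ℂ))
    (hF : ∀ y ∈ U, AnalyticAt ℂ F y) : (affineSpace n).presheaf.obj (op U) :=
  ⟨fun y : U => F y.1, fun y => contMDiffAt_subtype_iff.2
    (contMDiffAt_iff_contDiffAt.2 (hF y.1 y.2).contDiffAt)⟩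

lemma germ_eq_of_forall_eq {U V W : Opens (Fin n → ℂ)} {q : Fin n → ℂ} (hq : q ∈ W)
    (hU : W ≤ U) (hV : W ≤ V) (s : (affineSpace n).presheaf.obj (op U))
    (t : (affineSpace n).presheaf.obj (op V))
    (h : ∀ (y : Fin n → ℂ) (hy : y ∈ W), s.1 ⟨y, hU hy⟩ = t.1 ⟨y, hV hy⟩) :
    (affineSpace n).presheaf.germ U q (hU hq) s = (affineSpace n).presheaf.germ V q (hV hq) t :=
  TopCat.Presheaf.germ_ext _ W hq (homOfLE hU) (homOfLE hV)
    (Subtype.ext (funext fun y => h y.1 y.2))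

/-- The germ at `q` of a function which is analytic at `q`. -/
def analyticGerm {F : (Fin n → ℂ) → ℂ} {q : Fin n → ℂ} (hF : AnalyticAt ℂ F q) :
    (affineSpace n).presheaf.stalk q :=
  (affineSpace n).presheaf.germ ⟨{y | AnalyticAt ℂ F y}, isOpen_analyticAt ℂ F⟩ q hF
    (analyticSection F _ fun _ hy => hy)

lemma germ_analyticSection {F : (Fin n → ℂ) → ℂ} {q : Fin n → ℂ} (hF : AnalyticAt ℂ F q)
    {U : Opens (Fin n → ℂ)} (hq : q ∈ U) (hU : ∀ y ∈ U, AnalyticAt ℂ F y) :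
    (affineSpace n).presheaf.germ U q hq (analyticSection F U hU) = analyticGerm hF :=
  germ_eq_of_forall_eq hq le_rfl hU _ _ fun _ _ => rfl

lemma germ_eq_analyticGerm {F : (Fin n → ℂ) → ℂ} {q : Fin n → ℂ} (hF : AnalyticAt ℂ F q)
    {U : Opens (Fin n → ℂ)} (hq : q ∈ U) (s : (affineSpace n).presheaf.obj (op U))
    (h : ∀ᶠ y in 𝓝 q, ∀ hy : y ∈ U, s.1 ⟨y, hy⟩ = F y) :
    (affineSpace n).presheaf.germ U q hq s = analyticGerm hF := by
  obtain ⟨W, hW, hWo, hqW⟩ := eventually_nhds_iff.1 h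
  exact germ_eq_of_forall_eq
    (W := ⟨W, hWo⟩ ⊓ U ⊓ ⟨{y | AnalyticAt ℂ F y}, isOpen_analyticAt ℂ F⟩)
    ⟨⟨hqW, hq⟩, hF⟩ (fun _ hy => hy.1.2) (fun _ hy => hy.2) _ _
    fun y hy => hW y hy.1.1 hy.1.2

lemma analyticGerm_congr {F G : (Fin n → ℂ) → ℂ} {q : Fin n → ℂ} (hF : AnalyticAt ℂ F q)
    (hG : AnalyticAt ℂ G q) (h : F =ᶠ[𝓝 q] G) : analyticGerm hF = analyticGerm hG :=
  germ_eq_analyticGerm hG hF _ (h.mono fun _ hy _ => hy)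

lemma analyticGerm_add {F G : (Fin n → ℂ) → ℂ} {q : Fin n → ℂ} (hF : AnalyticAt ℂ F q)
    (hG : AnalyticAt ℂ G q) :
    analyticGerm (hF.add hG) = analyticGerm hF + analyticGerm hG := by
  let W : Opens (Fin n → ℂ) := ⟨{y | AnalyticAt ℂ F y}, isOpen_analyticAt ℂ F⟩ ⊓
    ⟨{y | AnalyticAt ℂ G y}, isOpen_analyticAt ℂ G⟩
  have hW : q ∈ W := ⟨hF, hG⟩
  rw [← germ_analyticSection hF hW fun _ hy => hy.1,
    ← germ_analyticSection hG hW fun _ hy => hy.2,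
    ← germ_analyticSection (hF.add hG) hW fun _ hy => hy.1.add hy.2, ← map_add]
  rfl

lemma analyticGerm_mul {F G : (Fin n → ℂ) → ℂ} {q : Fin n → ℂ} (hF : AnalyticAt ℂ F q)
    (hG : AnalyticAt ℂ G q) :
    analyticGerm (hF.mul hG) = analyticGerm hF * analyticGerm hG := by
  let W : Opens (Fin n → ℂ) := ⟨{y | AnalyticAt ℂ F y}, isOpen_analyticAt ℂ F⟩ ⊓
    ⟨{y | AnalyticAt ℂ G y}, isOpen_analyticAt ℂ G⟩
  have hW : q ∈ W := ⟨hF, hG⟩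
  rw [← germ_analyticSection hF hW fun _ hy => hy.1,
    ← germ_analyticSection hG hW fun _ hy => hy.2,
    ← germ_analyticSection (hF.mul hG) hW fun _ hy => hy.1.mul hy.2, ← map_mul]
  rfl

lemma analyticGerm_one (q : Fin n → ℂ) :
    analyticGerm (analyticAt_const (v := (1 : ℂ)) (x := q)) = 1 := by
  rw [← germ_analyticSection _ (U := ⊤) trivial fun _ _ => analyticAt_const,
    ← map_one ((affineSpace n).presheaf.germ ⊤ q trivial).hom]
  rfl

lemma analyticGerm_zero (q : Fin n → ℂ) :
    analyticGerm (analyticAt_const (v := (0 : ℂ)) (x := q)) = 0 := by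
  rw [← germ_analyticSection _ (U := ⊤) trivial fun _ _ => analyticAt_const,
    ← map_zero ((affineSpace n).presheaf.germ ⊤ q trivial).hom]
  rfl

lemma tendsto_sub_self (q : Fin n → ℂ) : Filter.Tendsto (fun y => y - q) (𝓝 q) (𝓝 0) := by
  have h : Continuous fun y => y - q := by fun_prop
  simpa using h.tendsto q

lemma analyticAt_evalFun_sub {a : MvPowerSeries (Fin n) ℂ} (ha : a ∈ convergentSeries n)
    (q : Fin n → ℂ) : AnalyticAt ℂ (fun y => evalFun a (y - q)) q :=
  AnalyticAt.comp_of_eq (analyticAt_evalFun ha) (analyticAt_id.sub analyticAt_const)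
    (sub_self q)

lemma eventually_mem_polydisc {a b : convergentSeries n} (q : Fin n → ℂ) :
    ∃ s, wnorm s a.1 ≠ ⊤ ∧ wnorm s b.1 ≠ ⊤ ∧ ∀ᶠ y in 𝓝 q, y - q ∈ polydisc s := by
  obtain ⟨s, hs⟩ := a.2
  obtain ⟨t, ht⟩ := b.2
  exact ⟨max s t, ne_top_of_le_ne_top hs (wnorm_anti (le_max_left _ _) _),
    ne_top_of_le_ne_top ht (wnorm_anti (le_max_right _ _) _),
    (tendsto_sub_self q).eventually (polydisc_mem_nhds _)⟩

/-- The homomorphism which sends a convergent power series to the germ of its sum. -/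
def seriesToStalk (q : Fin n → ℂ) : convergentSeries n →+* (affineSpace n).presheaf.stalk q where
  toFun a := analyticGerm (analyticAt_evalFun_sub a.2 q)
  map_one' := (analyticGerm_congr _ _
    (Filter.Eventually.of_forall fun _ => evalFun_one _)).trans (analyticGerm_one q)
  map_zero' := (analyticGerm_congr _ _
    (Filter.Eventually.of_forall fun _ => evalFun_zero _)).trans (analyticGerm_zero q)
  map_add' a b := by
    obtain ⟨s, ha, hb, hs⟩ := eventually_mem_polydisc (a := a) (b := b) q
    rw [← analyticGerm_add]
    exact analyticGerm_congr _ _ (hs.mono fun y hy => evalFun_add ha hb hy)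
  map_mul' a b := by
    obtain ⟨s, ha, hb, hs⟩ := eventually_mem_polydisc (a := a) (b := b) q
    rw [← analyticGerm_mul]
    exact analyticGerm_congr _ _ (hs.mono fun y hy => evalFun_mul ha hb hy)

/-- A section is bounded near `q` by continuity, so `exists_evalFun_eq` expands it. Surjectivity
alone carries the noetherian property over. -/
lemma seriesToStalk_surjective (q : Fin n → ℂ) : Function.Surjective (seriesToStalk q) := by
  intro g
  obtain ⟨(U : Opens (Fin n → ℂ)), hq, s, rfl⟩ := (affineSpace n).presheaf.exists_germ_eq g
  obtain ⟨f, hf⟩ : ∃ f : (Fin n → ℂ) → ℂ, ∀ y : U, f y.1 = s.1 y := by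
    classical
    exact ⟨fun y => if hy : y ∈ U then s.1 ⟨y, hy⟩ else 0, fun y => dif_pos y.2⟩
  have hfU : ∀ y ∈ U, ContDiffAt ℂ ∞ f y := fun y hy => by
    rw [← contMDiffAt_iff_contDiffAt]
    refine (contMDiffAt_subtype_iff (U := U) (x := ⟨y, hy⟩)).1 ?_
    rw [funext hf]
    exact s.2 ⟨y, hy⟩
  obtain ⟨r, hr, hrU⟩ := Metric.mem_nhds_iff.1 ((hfU q hq).continuousAt.norm.eventually_le_const
    (lt_add_one ‖f q‖) |>.and (U.isOpen.mem_nhds hq))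
  obtain ⟨a, ha, h⟩ := exists_evalFun_eq hr
    (fun y hy => (hfU y (hrU hy).2).contDiffWithinAt) fun y hy => (hrU hy).1
  refine ⟨⟨a, ha⟩, (germ_eq_analyticGerm _ hq s ?_).symm⟩
  filter_upwards [(tendsto_sub_self q).eventually h] with y hy hyU
  rw [← hf ⟨y, hyU⟩, ← hy, add_sub_cancel]

lemma isNoetherianRing_stalk_affineSpace (q : Fin n → ℂ) :
    IsNoetherianRing ((affineSpace n).presheaf.stalk q) :=
  have := isNoetherianRing_convergentSeries (n := n)
  isNoetherianRing_of_surjective _ _ (seriesToStalk q) (seriesToStalk_surjective q)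

lemma isNoetherianRing_of_isIso {A B : CommRingCat.{0}} (φ : A ⟶ B) [IsIso φ]
    [IsNoetherianRing A] : IsNoetherianRing B :=
  isNoetherianRing_of_surjective _ _ φ.hom (ConcreteCategory.bijective_of_isIso φ).2

lemma isNoetherianRing_stalk_holomorphicSpace (Ω : Opens (Fin n → ℂ)) (q : holomorphicSpace Ω) :
    IsNoetherianRing ((holomorphicSpace Ω).presheaf.stalk q) := by
  let j : holomorphicSpace Ω ⟶ affineSpace n := ChartedSpace.locallyRingedSpaceMap _
    (contMDiff_subtype_val (I := modelWithCornersSelf ℂ (Fin n → ℂ)) (U := Ω))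
  have : LocallyRingedSpace.IsOpenImmersion j := inferInstance
  have := isNoetherianRing_stalk_affineSpace (j.base q)
  exact isNoetherianRing_of_isIso (j.stalkMap q)

end HolomorphicStalk

/-! ### Stalks of analytic spaces are noetherian -/

lemma IsAnalyticSpace.isNoetherianRing_stalk {X : LocallyRingedSpace.{0}} (hX : IsAnalyticSpace X)
    (x : X) : IsNoetherianRing (X.presheaf.stalk x) := by
  obtain ⟨U, hxU, n, k, Ω, f, ι, hι, -, -⟩ := hX.exists_isLocalModel x
  let v : X.restrict U.isOpenEmbedding := ⟨x, hxU⟩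
  have := isNoetherianRing_stalk_holomorphicSpace Ω (ι.base v)
  have : IsNoetherianRing ((X.restrict U.isOpenEmbedding).presheaf.stalk v) :=
    isNoetherianRing_of_surjective _ _ (ι.stalkMap v).hom (hι.stalkMap_surjective v)
  let e := (X.restrictStalkIso U.isOpenEmbedding v).commRingCatIsoToRingEquiv
  exact isNoetherianRing_of_surjective _ _ e.toRingHom e.surjective

/-! ### Sections of a colimit of presheafed spaces -/

section ColimitSections

variable {J : Type u} [SmallCategory J] (G : J ⥤ PresheafedSpace.{_, _, u} CommRingCat.{u})

lemma exists_limit_eq {K : Type u} [SmallCategory K] (F : K ⥤ CommRingCat.{u})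
    (a : ∀ j, F.obj j) (ha : ∀ {j k} (f : j ⟶ k), F.map f (a j) = a k) :
    ∃ s : (limit F : CommRingCat.{u}), ∀ j, limit.π F j s = a j := by
  let e := Types.isLimitEquivSections (isLimitOfPreserves (forget CommRingCat.{u})
    (limit.isLimit F))
  refine ⟨e.symm ⟨a, ha⟩, fun j => ?_⟩
  exact Types.isLimitEquivSections_symm_apply (isLimitOfPreserves (forget CommRingCat.{u})
    (limit.isLimit F)) ⟨a, ha⟩ j

/-- Sections of the colimit over an open set form the limit of the sections over its preimages. The
isomorphism `e` allows `Y` to be a colimit computed in another category. -/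
lemma colimit_sections_ext {Y : PresheafedSpace.{_, _, u} CommRingCat.{u}}
    (e : colimit G ⟶ Y) [IsIso e] (β : ∀ j, G.obj j ⟶ Y) (hβ : β = fun j => colimit.ι G j ≫ e)
    (U : Opens Y) (s t : Y.presheaf.obj (op U))
    (h : ∀ j, (β j).c.app (op U) s = (β j).c.app (op U) t) : s = t := by
  subst hβ
  have : IsIso e.c := PresheafedSpace.c_isIso_of_iso e
  have : IsIso (e.c.app (op U)) := NatIso.isIso_app_of_isIso e.c (op U)
  have hb : Function.Bijective (e.c.app (op U)) := ConcreteCategory.bijective_of_isIso _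
  apply hb.1
  apply (ConcreteCategory.bijective_of_isIso
    (PresheafedSpace.colimitPresheafObjIsoComponentwiseLimit G _).hom).1
  apply Concrete.limit_ext
  intro j
  have hπ := PresheafedSpace.colimitPresheafObjIsoComponentwiseLimit_hom_π G
    ((Opens.map e.base).obj U) j.unop
  exact (ConcreteCategory.congr_hom hπ _).trans
    ((h j.unop).trans (ConcreteCategory.congr_hom hπ _).symm)

lemma exists_colimit_section {Y : PresheafedSpace.{_, _, u} CommRingCat.{u}}
    (e : colimit G ⟶ Y) [IsIso e] (β : ∀ j, G.obj j ⟶ Y) (hβ : β = fun j => colimit.ι G j ≫ e)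
    (U : Opens Y) (a : ∀ j, (G.obj j).presheaf.obj (op ((Opens.map (β j).base).obj U)))
    (ha : ∀ {j k} (f : j ⟶ k) (h : op ((Opens.map (G.map f).base).obj
      ((Opens.map (β k).base).obj U)) = op ((Opens.map (β j).base).obj U)),
      (G.obj j).presheaf.map (eqToHom h) ((G.map f).c.app _ (a k)) = a j) :
    ∃ s : Y.presheaf.obj (op U), ∀ j, (β j).c.app (op U) s = a j := by
  subst hβ
  have : IsIso e.c := PresheafedSpace.c_isIso_of_iso e
  have : IsIso (e.c.app (op U)) := NatIso.isIso_app_of_isIso e.c (op U)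
  have hb : Function.Bijective (e.c.app (op U)) := ConcreteCategory.bijective_of_isIso _
  obtain ⟨l, hl⟩ := exists_limit_eq
    (PresheafedSpace.componentwiseDiagram G ((Opens.map e.base).obj U)) (fun j => a j.unop)
    (fun {j k} f => ha f.unop _)
  obtain ⟨s, hs⟩ := hb.2 ((PresheafedSpace.colimitPresheafObjIsoComponentwiseLimit G _).inv l)
  refine ⟨s, fun j => ?_⟩
  change (colimit.ι G j).c.app _ (e.c.app (op U) s) = _
  rw [hs, ← hl (op j)]
  exact ConcreteCategory.congr_hom
    (PresheafedSpace.colimitPresheafObjIsoComponentwiseLimit_inv_ι_app G _ j) l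

end ColimitSections

/-! ### Sections of the gluing -/

section PushoutSections

variable {X Z : LocallyRingedSpace.{0}} (α : Z ⟶ X)

/-- The underlying presheafed space. -/
abbrev toPresheafedSpaceFunctor : LocallyRingedSpace.{0} ⥤ PresheafedSpace CommRingCat.{0} :=
  LocallyRingedSpace.forgetToSheafedSpace ⋙ SheafedSpace.forgetToPresheafedSpace

lemma c_app_eq_of_eq {X Y : LocallyRingedSpace.{0}} {f g : X ⟶ Y} (h : f = g) (U : Opens Y)
    (s t : Y.presheaf.obj (op U)) (hf : f.c.app (op U) s = f.c.app (op U) t) :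
    g.c.app (op U) s = g.c.app (op U) t := by
  subst h
  exact hf

lemma map_eqToHom_c_app {X : PresheafedSpace CommRingCat.{0}} {g : X ⟶ X} (hg : g = 𝟙 X)
    (U : Opens X) (c : X.presheaf.obj (op U)) (h : op ((Opens.map g.base).obj U) = op U) :
    X.presheaf.map (eqToHom h) (g.c.app (op U) c) = c := by
  subst hg
  change X.presheaf.map (𝟙 _) c = c
  rw [CategoryTheory.Functor.map_id]
  rfl

lemma gluing_section_ext (U : Opens (gluing α α)) (s t : (gluing α α).presheaf.obj (op U))
    (h₁ : (pushout.inl α α).c.app (op U) s = (pushout.inl α α).c.app (op U) t)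
    (h₂ : (pushout.inr α α).c.app (op U) s = (pushout.inr α α).c.app (op U) t) : s = t := by
  refine colimit_sections_ext (span α α ⋙ toPresheafedSpaceFunctor)
    (preservesColimitIso toPresheafedSpaceFunctor (span α α)).inv
    (fun j => toPresheafedSpaceFunctor.map (colimit.ι (span α α) j))
    (funext fun j => (ι_preservesColimitIso_inv toPresheafedSpaceFunctor (span α α) j).symm)
    U s t fun j => ?_
  match j with
  | some WalkingPair.left => exact h₁
  | some WalkingPair.right => exact h₂
  | none =>
    refine c_app_eq_of_eq (colimit.w (span α α) WalkingSpan.Hom.fst) U s t ?_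
    exact congrArg (α.c.app _) h₁

/-- The pushout is preserved on passing to presheafed spaces. Agreement on `Z` is tested on every
open `W` inside both preimages of `U`, since these preimages are equal only propositionally. -/
lemma exists_gluing_section (U : Opens (gluing α α))
    (a : X.presheaf.obj (op ((Opens.map (pushout.inl α α).base).obj U)))
    (b : X.presheaf.obj (op ((Opens.map (pushout.inr α α).base).obj U)))
    (hab : ∀ (W : Opens Z)
      (h₁ : W ≤ (Opens.map α.base).obj ((Opens.map (pushout.inl α α).base).obj U))
      (h₂ : W ≤ (Opens.map α.base).obj ((Opens.map (pushout.inr α α).base).obj U)),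
      Z.presheaf.map (homOfLE h₁).op (α.c.app _ a) = Z.presheaf.map (homOfLE h₂).op (α.c.app _ b)) :
    ∃ s : (gluing α α).presheaf.obj (op U),
      (pushout.inl α α).c.app (op U) s = a ∧ (pushout.inr α α).c.app (op U) s = b := by
  let G := span α α ⋙ toPresheafedSpaceFunctor
  let β : ∀ j, G.obj j ⟶ toPresheafedSpaceFunctor.obj (gluing α α) :=
    fun j => toPresheafedSpaceFunctor.map (colimit.ι (span α α) j)
  have hβ : ∀ {j k} (f : j ⟶ k), G.map f ≫ β k = β j := fun {j k} f => by
    exact (toPresheafedSpaceFunctor.map_comp _ _).symm.trans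
      (congrArg (fun g => toPresheafedSpaceFunctor.map g) (colimit.w (span α α) f))
  have hop : ∀ {j k} (f : j ⟶ k), op ((Opens.map (G.map f).base).obj
      ((Opens.map (β k).base).obj U)) = op ((Opens.map (β j).base).obj U) := fun {j k} f => by
    rw [← hβ f]
    rfl
  let c : ∀ j, (G.obj j).presheaf.obj (op ((Opens.map (β j).base).obj U)) := fun j =>
    match j with
    | some WalkingPair.left => a
    | some WalkingPair.right => b
    | none => Z.presheaf.map (eqToHom (hop WalkingSpan.Hom.fst)) (α.c.app _ a)
  obtain ⟨s, hs⟩ := exists_colimit_section G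
    (preservesColimitIso toPresheafedSpaceFunctor (span α α)).inv β
    (funext fun j => (ι_preservesColimitIso_inv toPresheafedSpaceFunctor (span α α) j).symm)
    U c (by
      rintro j k (_ | (_ | _)) h
      · exact map_eqToHom_c_app (G.map_id j) _ (c j) h
      · rfl
      · have hl := hop WalkingSpan.Hom.fst
        exact (hab ((Opens.map (β none).base).obj U) (le_of_eq (congrArg unop hl).symm)
          (le_of_eq (congrArg unop h).symm)).symm)
  exact ⟨s, hs WalkingSpan.left, hs WalkingSpan.right⟩

end PushoutSections

/-! ### The stalk of the gluing as a fibre product -/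

section PushoutStalks

lemma germ_c_app_of_eq {X Y : LocallyRingedSpace.{0}} {f g : X ⟶ Y} (h : f = g) (U : Opens Y)
    (s : Y.presheaf.obj (op U)) (x : X) (hf : f.base x ∈ U) (hg : g.base x ∈ U) :
    X.presheaf.germ ((Opens.map f.base).obj U) x hf (f.c.app (op U) s) =
      X.presheaf.germ ((Opens.map g.base).obj U) x hg (g.c.app (op U) s) := by
  subst h
  rfl

lemma c_app_map_apply {X Y : LocallyRingedSpace.{0}} (f : X ⟶ Y) {U U' : Opens Y} (i : U' ≤ U)
    (s : Y.presheaf.obj (op U)) :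
    f.c.app (op U') (Y.presheaf.map (homOfLE i).op s) =
      X.presheaf.map (homOfLE (fun _ hx => i hx :
        (Opens.map f.base).obj U' ≤ (Opens.map f.base).obj U)).op (f.c.app (op U) s) :=
  ConcreteCategory.congr_hom (f.c.naturality (homOfLE i).op) s

lemma map_map_apply {X : LocallyRingedSpace.{0}} {U V W : Opens X} (h : V ≤ U) (k : W ≤ V)
    (s : X.presheaf.obj (op U)) :
    X.presheaf.map (homOfLE k).op (X.presheaf.map (homOfLE h).op s) =
      X.presheaf.map (homOfLE (k.trans h)).op s := by
  rw [← ConcreteCategory.comp_apply, ← CategoryTheory.Functor.map_comp]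
  rfl

/-- The map of stalks at a point `v` equal to `f x`. -/
abbrev stalkMapAt {X Y : LocallyRingedSpace.{0}} (f : X ⟶ Y) (x : X) (v : Y) (h : f.base x = v) :
    Y.presheaf.stalk v ⟶ X.presheaf.stalk x :=
  Y.presheaf.stalkSpecializes (specializes_of_eq h) ≫ f.stalkMap x

lemma stalkMapAt_germ {X Y : LocallyRingedSpace.{0}} (f : X ⟶ Y) (x : X) (v : Y)
    (h : f.base x = v) (U : Opens Y) (hv : v ∈ U) (s : Y.presheaf.obj (op U)) :
    stalkMapAt f x v h (Y.presheaf.germ U v hv s) =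
      X.presheaf.germ ((Opens.map f.base).obj U) x (by rw [← h] at hv; exact hv)
        (f.c.app (op U) s) := by
  subst h
  rw [stalkMapAt, ConcreteCategory.comp_apply]
  erw [TopCat.Presheaf.germ_stalkSpecializes_apply]
  exact LocallyRingedSpace.stalkMap_germ_apply f U x hv s

variable {X Z : LocallyRingedSpace.{0}} (α : Z ⟶ X)

/-- The codiagonal of a gluing. -/
abbrev codiagonal : gluing α α ⟶ X := pushout.desc (𝟙 X) (𝟙 X) rfl

lemma codiagonal_inl (x : X) : (codiagonal α).base ((pushout.inl α α).base x) = x := by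
  change (pushout.inl α α ≫ codiagonal α).base x = x
  rw [pushout.inl_desc]
  rfl

lemma codiagonal_inr (x : X) : (codiagonal α).base ((pushout.inr α α).base x) = x := by
  change (pushout.inr α α ≫ codiagonal α).base x = x
  rw [pushout.inr_desc]
  rfl

/-- The stalk of a gluing along a closed immersion at a point of `Z` is a fibre product. -/
theorem isFibreProduct_stalk (hα : IsClosedImmersion α) (z : Z) (v : gluing α α)
    (h₁ : (pushout.inl α α).base (α.base z) = v) (h₂ : (pushout.inr α α).base (α.base z) = v) :
    IsFibreProduct (stalkMapAt (pushout.inl α α) (α.base z) v h₁).hom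
      (stalkMapAt (pushout.inr α α) (α.base z) v h₂).hom (α.stalkMap z).hom where
  comm a := by
    obtain ⟨U, hv, s, rfl⟩ := (gluing α α).presheaf.exists_germ_eq a
    change α.stalkMap z (stalkMapAt _ _ _ _ _) = α.stalkMap z (stalkMapAt _ _ _ _ _)
    rw [stalkMapAt_germ, stalkMapAt_germ]
    erw [LocallyRingedSpace.stalkMap_germ_apply, LocallyRingedSpace.stalkMap_germ_apply]
    exact germ_c_app_of_eq pushout.condition U s z _ _
  ext a b hab₁ hab₂ := by
    rw [← sub_eq_zero] at hab₁ hab₂ ⊢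
    rw [← map_sub] at hab₁ hab₂
    generalize a - b = c at hab₁ hab₂ ⊢
    obtain ⟨U, hv, s, rfl⟩ := (gluing α α).presheaf.exists_germ_eq c
    replace hab₁ : stalkMapAt _ _ _ _ _ = 0 := hab₁
    replace hab₂ : stalkMapAt _ _ _ _ _ = 0 := hab₂
    rw [stalkMapAt_germ] at hab₁ hab₂
    have m₁ : α.base z ∈ (Opens.map (pushout.inl α α).base).obj U := by
      rw [← h₁] at hv
      exact hv
    have m₂ : α.base z ∈ (Opens.map (pushout.inr α α).base).obj U := by
      rw [← h₂] at hv
      exact hv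
    obtain ⟨W₁, hW₁, i₁, j₁, e₁⟩ := X.presheaf.germ_eq (α.base z) m₁ m₁ _ 0
      (hab₁.trans (map_zero (X.presheaf.germ _ (α.base z) m₁).hom).symm)
    obtain ⟨W₂, hW₂, i₂, j₂, e₂⟩ := X.presheaf.germ_eq (α.base z) m₂ m₂ _ 0
      (hab₂.trans (map_zero (X.presheaf.germ _ (α.base z) m₂).hom).symm)
    rw [map_zero] at e₁ e₂
    -- The codiagonal retracts both inclusions, so this neighbourhood of `v` has traces inside `W₁`
    -- and `W₂`, where the two restrictions of `s` vanish.
    let U' : Opens (gluing α α) := U ⊓ (Opens.map (codiagonal α).base).obj (W₁ ⊓ W₂)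
    have hU' : U' ≤ U := inf_le_left
    have hv' : v ∈ U' := ⟨hv, by
      change (codiagonal α).base v ∈ W₁ ⊓ W₂
      rw [← h₁, codiagonal_inl]
      exact ⟨hW₁, hW₂⟩⟩
    have k₁ : (Opens.map (pushout.inl α α).base).obj U' ≤ W₁ := fun y hy => by
      have := hy.2.1
      change (codiagonal α).base ((pushout.inl α α).base y) ∈ W₁ at this
      rwa [codiagonal_inl] at this
    have k₂ : (Opens.map (pushout.inr α α).base).obj U' ≤ W₂ := fun y hy => by
      have := hy.2.2
      change (codiagonal α).base ((pushout.inr α α).base y) ∈ W₂ at this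
      rwa [codiagonal_inr] at this
    have key : (gluing α α).presheaf.map (homOfLE hU').op s = 0 := by
      apply gluing_section_ext
      · rw [c_app_map_apply, map_zero, ← map_map_apply (leOfHom i₁) k₁]
        exact (congrArg (X.presheaf.map (homOfLE k₁).op) e₁).trans (map_zero _)
      · rw [c_app_map_apply, map_zero, ← map_map_apply (leOfHom i₂) k₂]
        exact (congrArg (X.presheaf.map (homOfLE k₂).op) e₂).trans (map_zero _)
    rw [← (gluing α α).presheaf.germ_res_apply (homOfLE hU') v hv' s]
    erw [key]
    exact map_zero _
  exists_eq r r' hr := by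
    obtain ⟨A, hA, a, rfl⟩ := X.presheaf.exists_germ_eq r
    obtain ⟨B, hB, b, rfl⟩ := X.presheaf.exists_germ_eq r'
    replace hr : α.stalkMap z _ = α.stalkMap z _ := hr
    erw [LocallyRingedSpace.stalkMap_germ_apply, LocallyRingedSpace.stalkMap_germ_apply] at hr
    obtain ⟨W, hW, i₁, i₂, e⟩ := Z.presheaf.germ_eq _ _ _ _ _ hr
    -- Since `Z` carries the induced topology, the neighbourhood in `Z` on which the germs agree
    -- extends to an open set of `X`; its pullback by the codiagonal is where the two sections glue.
    obtain ⟨W', hW'o, hW'⟩ := hα.isClosedEmbedding.isInducing.isOpen_iff.1 W.2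
    let V₀ : Opens X := A ⊓ B ⊓ ⟨W', hW'o⟩
    have hV₀ : α.base z ∈ V₀ := ⟨⟨hA, hB⟩, by
      have : z ∈ α.base ⁻¹' W' := by rw [hW']; exact hW
      exact this⟩
    let U : Opens (gluing α α) := (Opens.map (codiagonal α).base).obj V₀
    have hv : v ∈ U := by
      change (codiagonal α).base v ∈ V₀
      rwa [← h₁, codiagonal_inl]
    have k₁ : (Opens.map (pushout.inl α α).base).obj U ≤ V₀ := fun y hy => by
      change (codiagonal α).base ((pushout.inl α α).base y) ∈ V₀ at hy
      rwa [codiagonal_inl] at hy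
    have k₂ : (Opens.map (pushout.inr α α).base).obj U ≤ V₀ := fun y hy => by
      change (codiagonal α).base ((pushout.inr α α).base y) ∈ V₀ at hy
      rwa [codiagonal_inr] at hy
    have kA : (Opens.map (pushout.inl α α).base).obj U ≤ A := fun y hy => (k₁ hy).1.1
    have kB : (Opens.map (pushout.inr α α).base).obj U ≤ B := fun y hy => (k₂ hy).1.2
    obtain ⟨s, hs₁, hs₂⟩ := exists_gluing_section α U (X.presheaf.map (homOfLE kA).op a)
      (X.presheaf.map (homOfLE kB).op b) (by
        intro W'' l₁ l₂
        have l : W'' ≤ W := fun y hy => by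
          have : y ∈ α.base ⁻¹' W' := (k₁ (l₁ hy)).2
          rw [hW'] at this
          exact this
        have e' := congrArg (Z.presheaf.map (homOfLE l).op) e
        rw [c_app_map_apply, c_app_map_apply]
        exact (map_map_apply _ _ _).trans ((map_map_apply (leOfHom i₁) l _).symm.trans
          (e'.trans ((map_map_apply (leOfHom i₂) l _).trans (map_map_apply _ _ _).symm))))
    refine ⟨(gluing α α).presheaf.germ U v hv s, ?_, ?_⟩
    · refine (stalkMapAt_germ _ _ _ _ _ _ _).trans ?_
      rw [hs₁]
      exact X.presheaf.germ_res_apply (homOfLE kA) _ _ a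
    · refine (stalkMapAt_germ _ _ _ _ _ _ _).trans ?_
      rw [hs₂]
      exact X.presheaf.germ_res_apply (homOfLE kB) _ _ b

end PushoutStalks

/-! ### Transport of germ invariants to a common base point -/

section GermSeries

variable {X Y Z : LocallyRingedSpace.{0}}

lemma stalkMapAt_rfl (f : X ⟶ Y) (x : X) : stalkMapAt f x _ rfl = f.stalkMap x := by
  rw [stalkMapAt, TopCat.Presheaf.stalkSpecializes_refl, Category.id_comp]

lemma stalkMapAt_comp (f : X ⟶ Y) (g : Y ⟶ Z) (x : X) (y : Y) (z : Z) (hy : f.base x = y)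
    (hz : g.base y = z) (h : (f ≫ g).base x = z) :
    stalkMapAt (f ≫ g) x z h = stalkMapAt g y z hz ≫ stalkMapAt f x y hy := by
  subst hy hz
  rw [stalkMapAt_rfl, stalkMapAt_rfl]
  exact (stalkMapAt_rfl _ _).trans (LocallyRingedSpace.stalkMap_comp f g x)

/-- Image points such as `α.base z`, `ι.base w` and `x` are only propositionally equal; this places
all modules over the stalk at one chosen point. -/
lemma germPoincareSeries_eq (f : X ⟶ Y) (x : X) (y : Y) (h : f.base x = y) :
    germPoincareSeries f x = poincareSeries _ (ringModule (stalkMapAt f x y h).hom) := by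
  subst h
  rw [stalkMapAt_rfl]
  rfl

lemma finiteBetti_iff (f : X ⟶ Y) (x : X) (y : Y) (h : f.base x = y) :
    FiniteBetti f x ↔ HasFiniteBettiNumbers _ (ringModule (stalkMapAt f x y h).hom) := by
  subst h
  rw [stalkMapAt_rfl]
  rfl

lemma surjective_stalkMapAt {f : X ⟶ Y} (hf : IsClosedImmersion f) (x : X) (y : Y)
    (h : f.base x = y) : Function.Surjective (stalkMapAt f x y h).hom := by
  subst h
  rw [stalkMapAt_rfl]
  exact hf.stalkMap_surjective x

/-- The Poincaré series of a nonzero cyclic module has constant term 1, so the difference has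
constant term 1 too. -/
lemma isUnit_two_sub_poincareSeries {R S : Type} [CommRing R] [CommRing S] [IsLocalRing R]
    [Nontrivial S] (σ : R →+* S) (hσ : Function.Surjective σ) :
    IsUnit (2 - poincareSeries R (ringModule σ)) := by
  rw [PowerSeries.isUnit_iff_constantCoeff, poincareSeries_ringModule σ hσ, map_sub, map_add,
    map_mul, PowerSeries.constantCoeff_X, map_one, map_ofNat]
  norm_num

end GermSeries

end Gluing

end

/-! ### The formula for the gluing -/

theorem corollary3p13
    {X Z W : LocallyRingedSpace.{0}}
    (hX : Gluing.IsAnalyticSpace X) (hZ : Gluing.IsAnalyticSpace Z)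
    (hW : Gluing.IsAnalyticSpace W)
    (α : Z ⟶ X) (hα : Gluing.IsClosedImmersion α)
    (ι : W ⟶ X) (hι : Gluing.IsClosedImmersion ι)
    (x : X) (z : Z) (hz : α.base z = x) (w : W) (hw : ι.base w = x) :
    (Gluing.FiniteBetti α z ∧ Gluing.FiniteBetti ι w) ∧
    IsUnit (2 - Gluing.germPoincareSeries α z) ∧
    ∀ f ∈ ({pushout.inl α α, pushout.inr α α} : Set (X ⟶ Gluing.gluing α α)),
      Gluing.FiniteBetti (ι ≫ f) w ∧
      Gluing.germPoincareSeries (ι ≫ f) w * (2 - Gluing.germPoincareSeries α z) =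
        Gluing.germPoincareSeries ι w := by
  have hR := hX.isNoetherianRing_stalk x
  have hσ := Gluing.surjective_stalkMapAt hα z x hz
  have hω := Gluing.surjective_stalkMapAt hι w x hw
  have h₁ : (pushout.inl α α).base x = (pushout.inl α α).base x := rfl
  have h₂ : (pushout.inr α α).base x = (pushout.inl α α).base x := by
    rw [← hz]
    change (α ≫ pushout.inr α α).base z = (α ≫ pushout.inl α α).base z
    rw [pushout.condition]
  have hA : Gluing.IsFibreProduct (Gluing.stalkMapAt (pushout.inl α α) x _ h₁).hom
      (Gluing.stalkMapAt (pushout.inr α α) x _ h₂).hom (Gluing.stalkMapAt α z x hz).hom := by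
    subst hz
    rw [Gluing.stalkMapAt_rfl α z]
    exact Gluing.isFibreProduct_stalk α hα z _ h₁ h₂
  rw [Gluing.finiteBetti_iff α z x hz, Gluing.finiteBetti_iff ι w x hw,
    Gluing.germPoincareSeries_eq α z x hz, Gluing.germPoincareSeries_eq ι w x hw]
  refine ⟨⟨Gluing.hasFiniteBettiNumbers_of_surjective _ hσ,
    Gluing.hasFiniteBettiNumbers_of_surjective _ hω⟩,
    Gluing.isUnit_two_sub_poincareSeries _ hσ, ?_⟩
  rintro f (rfl | rfl)
  · have h : (ι ≫ pushout.inl α α).base w = (pushout.inl α α).base x :=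
      congrArg (pushout.inl α α).base hw
    rw [Gluing.finiteBetti_iff _ w _ h, Gluing.germPoincareSeries_eq _ w _ h,
      Gluing.stalkMapAt_comp ι _ w x _ hw h₁ h]
    exact hA.poincareSeries_comp hσ _ hω
  -- The second copy is handled by exchanging the two projections of the fibre product.
  · have h : (ι ≫ pushout.inr α α).base w = (pushout.inl α α).base x :=
      (congrArg (pushout.inr α α).base hw).trans h₂
    rw [Gluing.finiteBetti_iff _ w _ h, Gluing.germPoincareSeries_eq _ w _ h,
      Gluing.stalkMapAt_comp ι _ w x _ hw h₂ h]
    exact hA.symm.poincareSeries_comp hσ _ hω
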